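/- **Arrow algebras.** An *arrow algebra* $\mathcal A=(A,\le,\to,S)$ is a poset $(A,\le)$ with all meets, an operation $\to$ antitone in the first and monotone in the second argument, and a subset $S\subseteq A$ (the separator) that is upward closed, closed under modus ponens, and contains $\bigwedge_{a,b}a\to b\to a$, $\ \bigwedge_{a,b,c}(a\to b\to c)\to(a\to b)\to(a\to c)$ and $\bigwedge_{a,(b_i)_{i\in I},(c_i)_{i\in I}}\big(\bigwedge_i a\to b_i\to c_i\big)\to a\to\bigwedge_i(b_i\to c_i)$. It is *modifiable* if $a\to(b\wedge c)=(a\to b)\wedge(a\to c)$ and $\bot\to a=\top$ for all $a,b,c\in A$. Put $\partial a:=\top\to a$ and $a+b:=\bigwedge_{c}(a\to\partial c)\to(b\to\partial c)\to\partial c$. The *arrow tripos* $P_{\mathcal A}$ sends a set $I$ to the functions $I\to A$ preordered by $\varphi\vdash_I\psi\iff\bigwedge_{i}\varphi(i)\to\psi(i)\in S$, with reindexing by precomposition. **Subtriposes.** A *($\mathbf{Set}$-)tripos* is a pseudofunctor $P$ from $\mathbf{Set}^{\mathrm{op}}$ to Heyting prealgebras (preorders whose poset reflection is a Heyting algebra)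 such that every reindexing map $P(f)$ has a left and a right adjoint among monotone maps, these satisfy the Beck–Chevalley condition, and $P$ has a generic element. A *geometric morphism* $\Phi:Q\to P$ of triposes is a pair of families of monotone maps $\Phi^+_I:P(I)\to Q(I)$ and $\Phi_{+,I}:Q(I)\to P(I)$, natural in the set $I$ up to isomorphism, such that $\Phi^+_I\dashv\Phi_{+,I}$ and $\Phi^+_I$ preserves finite meets. It is an *inclusion* if each $\Phi_{+,I}$ reflects the order. A *subtripos* of $P$ is a tripos with a geometric inclusion into $P$. Subtriposes are preordered by factorization up to isomorphism, and are *equivalent* if each factors through the other. A subtripos $\Phi$ is *open with witness* $\alpha\in P(1)$ if $\Phi_+\Phi^+(\varphi)\simeq (P(!)(\alpha)\to\varphi)$, and *closed with witness* $\beta\in P(1)$ if $\Phi_+\Phi^+(\varphi)\simeq \varphi\vee P(!)(\beta)$, for all sets $I$ and $\varphi\in P(I)$, where $!:I\to 1$. A *nucleus* on $\mathcal A$ is a monotone $j:A\to A$ with $\bigwedge_a a\to ja\in S$ and $\bigwedge_{a,b}(a\to jb)\to ja\to jb\in S$. It yields an arrow algebra $\mathcal A_j=(A,\le,\ a\to_j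 b:=a\to jb,\ \{a\mid ja\in S\})$ and a subtripos $P_{\mathcal A_j}\hookrightarrow P_{\mathcal A}$ with inverse image $\mathrm{id}_A\circ-$ and direct image $j\circ-$. **The Sierpiński construction.** For modifiable $\mathcal A$, let $\mathcal A^{\to}$ be the arrow algebra of pairs $x=(x_0,x_1)\in A^2$ with $x_0\le x_1$, ordered pointwise, with $x\to y:=\big((x_0\to y_0)\wedge(x_1\to y_1),\,x_1\to y_1\big)$ and separator $\{x\mid x_0\in S\}$. The projection $\pi_1(x_0,x_1)=x_1$ and the diagonal $\delta(a)=(a,a)$ induce a subtripos $\Phi_1:P_{\mathcal A}\hookrightarrow P_{\mathcal A^{\to}}$ with inverse image $\pi_1\circ-$ and direct image $\delta\circ-$. Let $\mathcal A^m:=(\mathcal A^{\to})_c$ for the nucleus $c(x):=x+(\bot,\top)$ on $\mathcal A^{\to}$, and let $M_{\mathcal A}:=P_{\mathcal A^m}\hookrightarrow P_{\mathcal A^{\to}}$ be the subtripos induced by $c$. **Proposition 9.11.** Let $\mathcal A$ be a modifiable arrow algebra. Then: 1. $\Phi_1:P_{\mathcal A}\hookrightarrow P_{\mathcal A^{\to}}$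 is open with witness $(\bot,\top)$, and it is equivalent to the subtripos of $P_{\mathcal A^{\to}}$ induced by the nucleus $o(x):=(\bot,\top)\to x$. 2. $M_{\mathcal A}$ is closed with witness $(\bot,\top)$, and it is the complement of $P_{\mathcal A}$ in the lattice of subtriposes of $P_{\mathcal A^{\to}}$ up to equivalence: the two have meet the least and join the greatest element, and every complement of $P_{\mathcal A}$ is equivalent to $M_{\mathcal A}$. -/

import Mathlib

universe u v w

/-! ## Arrow algebras -/

/-- An arrow algebra `(A, ≤, →, S)`: a poset with all meets (presented as a complete lattice),
an operation `→` antitone in the first and monotone in the second variable, and a separator `S`,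
i.e. an upward closed subset, closed under modus ponens and containing the combinators
`k`, `s` and `a`. -/
structure ArrowAlgebra where
  /-- the underlying set -/
  carrier : Type u
  /-- the evidential order -/
  [lattice : CompleteLattice carrier]
  /-- the implication -/
  imp : carrier → carrier → carrier
  imp_mono : ∀ {a a' b b' : carrier}, a' ≤ a → b ≤ b' → imp a b ≤ imp a' b'
  /-- the separator -/
  sep : Set carrier
  sep_upward : ∀ {a b : carrier}, a ∈ sep → a ≤ b → b ∈ sep
  sep_mp : ∀ {a b : carrier}, imp a b ∈ sep → a ∈ sep → b ∈ sep
  sep_k : (⨅ (a : carrier) (b : carrier), imp a (imp b a)) ∈ sep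
  sep_s : (⨅ (a : carrier) (b : carrier) (c : carrier),
    imp (imp a (imp b c)) (imp (imp a b) (imp a c))) ∈ sep
  sep_a : (⨅ (a : carrier) (I : Type u) (b : I → carrier) (c : I → carrier),
    imp (⨅ i, imp a (imp (b i) (c i))) (imp a (⨅ i, imp (b i) (c i)))) ∈ sep

namespace ArrowAlgebra

attribute [instance] ArrowAlgebra.lattice

/-- Binary implicative arrow algebras: `a → (b ∧ c) = (a → b) ∧ (a → c)`. -/
def BinaryImplicative (A : ArrowAlgebra.{u}) : Prop :=
  ∀ a b c : A.carrier, A.imp a (b ⊓ c) = A.imp a b ⊓ A.imp a c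

/-- Modifiable arrow algebras: binary implicative ones in which `⊥ → a = ⊤`. -/
structure Modifiable (A : ArrowAlgebra.{u}) : Prop where
  binaryImplicative : A.BinaryImplicative
  bot_imp : ∀ a : A.carrier, A.imp ⊥ a = ⊤

/-- The logical order on `I`-indexed families: `φ ⊢_I ψ` iff `⋀ i, φ i → ψ i` is in the
separator. -/
def Entails (A : ArrowAlgebra.{u}) {I : Sort v} (φ ψ : I → A.carrier) : Prop :=
  (⨅ i, A.imp (φ i) (ψ i)) ∈ A.sep

/-- `∂ a := ⊤ → a`. -/
def del (A : ArrowAlgebra.{u}) (a : A.carrier) : A.carrier := A.imp ⊤ a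

/-- The logical join `a + b := ⋀ c, (a → ∂c) → (b → ∂c) → ∂c`. -/
def plus (A : ArrowAlgebra.{u}) (a b : A.carrier) : A.carrier :=
  ⨅ c, A.imp (A.imp a (A.del c)) (A.imp (A.imp b (A.del c)) (A.del c))

/-- An auxiliary logical meet, `⋀ c, (a → b → ∂c) → ∂c`. -/
def conj (A : ArrowAlgebra.{u}) (a b : A.carrier) : A.carrier :=
  ⨅ c, A.imp (A.imp a (A.imp b (A.del c))) (A.del c)

section Logic

variable {A : ArrowAlgebra.{u}} {I : Sort v} {K : Sort w}

/-- auxiliary: the family is realized uniformly -/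
def Valid (A : ArrowAlgebra.{u}) {I : Sort v} (x : I → A.carrier) : Prop := (⨅ i, x i) ∈ A.sep

theorem Valid.of_le {x : I → A.carrier} {y : K → A.carrier} (h : A.Valid x)
    (hxy : ∀ k, ∃ i, x i ≤ y k) : A.Valid y :=
  A.sep_upward h (le_iInf fun k => (hxy k).elim fun i hi => (iInf_le x i).trans hi)

theorem valid_k (x y : I → A.carrier) : A.Valid fun i => A.imp (x i) (A.imp (y i) (x i)) :=
  A.sep_upward A.sep_k (le_iInf fun i => (iInf_le _ (x i)).trans (iInf_le _ (y i)))

theorem valid_s (x y z : I → A.carrier) : A.Valid fun i =>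
    A.imp (A.imp (x i) (A.imp (y i) (z i))) (A.imp (A.imp (x i) (y i)) (A.imp (x i) (z i))) :=
  A.sep_upward A.sep_s (le_iInf fun i =>
    ((iInf_le _ (x i)).trans (iInf_le _ (y i))).trans (iInf_le _ (z i)))

/-- the combinator `a`, for index types in any universe -/
theorem a_le (A : ArrowAlgebra.{u}) : ∃ r ∈ A.sep, ∀ (K : Sort w) (a : A.carrier)
    (b c : K → A.carrier),
    r ≤ A.imp (⨅ k, A.imp a (A.imp (b k) (c k))) (A.imp a (⨅ k, A.imp (b k) (c k))) := by
  refine ⟨_, A.sep_a, fun K a b c => ?_⟩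
  let J : Type u := {p : A.carrier × A.carrier // ∃ k, p = (b k, c k)}
  refine iInf_le_of_le a ?_
  refine iInf_le_of_le J ?_
  refine iInf_le_of_le (fun j : J => j.1.1) ?_
  refine iInf_le_of_le (fun j : J => j.1.2) ?_
  refine A.imp_mono (le_iInf ?_) (A.imp_mono le_rfl (le_iInf fun k => ?_))
  · rintro ⟨_, k, rfl⟩
    exact iInf_le _ k
  · exact iInf_le (fun j : J => A.imp j.1.1 j.1.2) ⟨_, k, rfl⟩

theorem Valid.mp {x y z : I → A.carrier} (h : A.Valid fun i => A.imp (x i) (A.imp (y i) (z i)))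
    (hx : A.Valid x) : A.Valid fun i => A.imp (y i) (z i) := by
  obtain ⟨r, hr, har⟩ := A.a_le
  have h1 : A.imp (⨅ i, A.imp (⨅ i, x i) (A.imp (y i) (z i)))
      (A.imp (⨅ i, x i) (⨅ i, A.imp (y i) (z i))) ∈ A.sep :=
    A.sep_upward hr (har I _ y z)
  have h2 : A.Valid fun i => A.imp (⨅ i, x i) (A.imp (y i) (z i)) :=
    h.of_le fun i => ⟨i, A.imp_mono (iInf_le _ i) le_rfl⟩
  exact A.sep_mp (A.sep_mp h1 h2) hx

theorem Entails.of_le {φ ψ : I → A.carrier} (h : ∀ i, φ i ≤ ψ i) : A.Entails φ ψ := by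
  have h1 : A.Valid fun i => A.imp (φ i) (φ i) :=
    ((valid_s φ (fun i => A.imp (φ i) (φ i)) φ).mp (valid_k _ _)).mp (valid_k _ _)
  exact h1.of_le fun i => ⟨i, A.imp_mono le_rfl (h i)⟩

theorem Entails.refl (φ : I → A.carrier) : A.Entails φ φ := .of_le fun _ => le_rfl

theorem Entails.post {x y : I → A.carrier} (h : A.Entails x y) (z : I → A.carrier) :
    A.Entails (fun i => A.imp (z i) (x i)) fun i => A.imp (z i) (y i) :=
  (valid_s z x y).mp ((valid_k (fun i => A.imp (x i) (y i)) z).mp h)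

theorem Entails.app {g x y : I → A.carrier} (h : A.Entails g fun i => A.imp (x i) (y i))
    (hx : A.Entails g x) : A.Entails g y :=
  ((valid_s g x y).mp h).mp hx

theorem Valid.weaken {x y : I → A.carrier} (h : A.Valid x) : A.Entails y x :=
  (valid_k x y).mp h

theorem Entails.trans {x y z : I → A.carrier} (h : A.Entails x y) (h' : A.Entails y z) :
    A.Entails x z :=
  Entails.app (Valid.weaken (x := fun i => A.imp (y i) (z i)) h') h

theorem Entails.pre {x x' : I → A.carrier} (h : A.Entails x' x) (y : I → A.carrier) :
    A.Entails (fun i => A.imp (x i) (y i)) fun i => A.imp (x' i) (y i) :=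
  Entails.app (Entails.trans (valid_k _ _) (valid_s x' x y))
    (Valid.weaken (x := fun i => A.imp (x' i) (x i)) h)

theorem entails_k (x y : I → A.carrier) : A.Entails x fun i => A.imp (y i) (x i) := valid_k x y

theorem entails_flip (x y z : I → A.carrier) :
    A.Entails (fun i => A.imp (x i) (A.imp (y i) (z i)))
      fun i => A.imp (y i) (A.imp (x i) (z i)) :=
  Entails.trans (valid_s x y z) (Entails.pre (entails_k y x) _)

theorem Entails.flip {x y z : I → A.carrier} (h : A.Entails x fun i => A.imp (y i) (z i)) :
    A.Entails y fun i => A.imp (x i) (z i) :=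
  Valid.mp (x := fun i => A.imp (x i) (A.imp (y i) (z i))) (entails_flip x y z) h

theorem Entails.reindex {x y : I → A.carrier} (h : A.Entails x y) (f : K → I) :
    A.Entails (fun k => x (f k)) fun k => y (f k) :=
  Valid.of_le (x := fun i => A.imp (x i) (y i)) h fun k => ⟨f k, le_rfl⟩

theorem Entails.top (x : I → A.carrier) : A.Entails x fun _ => ⊤ := .of_le fun _ => le_top

theorem entails_del (x : I → A.carrier) : A.Entails x fun i => A.del (x i) := entails_k x _

theorem del_entails (x : I → A.carrier) : A.Entails (fun i => A.del (x i)) x :=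
  Entails.app (x := fun _ => ⊤) (Entails.refl _) (Entails.top _)

/-- uniform families of implications may be gathered by a meet -/
theorem entails_iInf {I : Sort v} {κ : I → Sort w} {x : I → A.carrier}
    {b c : ∀ i, κ i → A.carrier}
    (h : A.Entails (fun p : (Σ' i, κ i) => x p.1)
      fun p : (Σ' i, κ i) => A.imp (b p.1 p.2) (c p.1 p.2)) :
    A.Entails x fun i => ⨅ k, A.imp (b i k) (c i k) := by
  obtain ⟨r, hr, har⟩ := A.a_le.{u, w}
  have h1 : A.Valid fun i => A.imp (⨅ k, A.imp (x i) (A.imp (b i k) (c i k)))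
      (A.imp (x i) (⨅ k, A.imp (b i k) (c i k))) :=
    A.sep_upward hr (le_iInf fun i => har _ _ _ _)
  refine h1.mp ?_
  refine A.sep_upward h (le_iInf fun i => le_iInf fun k => ?_)
  exact iInf_le (fun p : (Σ' i, κ i) => A.imp (x p.1) (A.imp (b p.1 p.2) (c p.1 p.2))) ⟨i, k⟩

/-- if `p` is realized uniformly then so is `(p → ∂y) → y` -/
theorem Valid.elim {p y : I → A.carrier} (h : A.Valid p) :
    A.Entails (fun i => A.imp (p i) (A.del (y i))) y :=
  (Entails.app (x := p) (Entails.refl _) h.weaken).trans (del_entails y)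

theorem conj_left (x y : I → A.carrier) : A.Entails (fun i => A.conj (x i) (y i)) x := by
  refine Entails.trans (.of_le fun i => iInf_le _ (x i)) (Valid.elim ?_)
  exact (entails_del x).trans (entails_k _ _)

theorem conj_right (x y : I → A.carrier) : A.Entails (fun i => A.conj (x i) (y i)) y := by
  refine Entails.trans (.of_le fun i => iInf_le _ (y i)) (Valid.elim ?_)
  exact Valid.weaken (x := fun i => A.imp (y i) (A.del (y i))) (entails_del y)

theorem pair_entails (x y : I → A.carrier) :
    A.Entails x fun i => A.imp (y i) (A.conj (x i) (y i)) := by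
  obtain ⟨r, hr, har⟩ := A.a_le.{u, u + 1}
  have h1 : A.Entails x fun i => ⨅ c, A.imp (y i)
      (A.imp (A.imp (x i) (A.imp (y i) (A.del c))) (A.del c)) := by
    refine entails_iInf (κ := fun _ => A.carrier) ?_
    refine Entails.trans (Entails.flip (Entails.refl fun p : (Σ' _ : I, A.carrier) =>
      A.imp (x p.1) (A.imp (y p.1) (A.del p.2)))) ?_
    exact entails_flip _ _ _
  refine h1.trans ?_
  exact A.sep_upward hr (le_iInf fun i => har _ _ _ _)

theorem Entails.curry {g x y : I → A.carrier} (h : A.Entails (fun i => A.conj (g i) (x i)) y) :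
    A.Entails g fun i => A.imp (x i) (y i) :=
  (pair_entails g x).trans (h.post x)

theorem Entails.conj {g x y : I → A.carrier} (hx : A.Entails g x) (hy : A.Entails g y) :
    A.Entails g fun i => A.conj (x i) (y i) :=
  Entails.app (hx.trans (pair_entails x y)) hy

theorem Entails.uncurry {g x y : I → A.carrier} (h : A.Entails g fun i => A.imp (x i) (y i)) :
    A.Entails (fun i => A.conj (g i) (x i)) y :=
  Entails.app ((conj_left g x).trans h) (conj_right g x)

theorem plus_left (x y : I → A.carrier) : A.Entails x fun i => A.plus (x i) (y i) := by
  refine entails_iInf (κ := fun _ => A.carrier) ?_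
  refine Entails.curry ?_
  exact (Entails.app (conj_right _ _) (conj_left _ _)).trans (entails_k _ _)

theorem plus_right (x y : I → A.carrier) : A.Entails y fun i => A.plus (x i) (y i) := by
  refine entails_iInf (κ := fun _ => A.carrier) ?_
  refine Entails.curry (Entails.curry ?_)
  exact Entails.app (conj_right _ _) ((conj_left _ _).trans (conj_left _ _))

theorem Entails.plus {x y z : I → A.carrier} (hx : A.Entails x z) (hy : A.Entails y z) :
    A.Entails (fun i => A.plus (x i) (y i)) z := by
  refine Entails.trans (.of_le fun i => iInf_le _ (z i)) ?_
  refine Entails.trans (Entails.app (Entails.app (Entails.refl _) ?_) ?_) (del_entails z)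
  · exact Valid.weaken (x := fun i => A.imp (x i) (A.del (z i))) (hx.trans (entails_del z))
  · exact Valid.weaken (x := fun i => A.imp (y i) (A.del (z i))) (hy.trans (entails_del z))

end Logic

end ArrowAlgebra

/-! ## Heyting prealgebras and triposes over the category of sets -/

/-- `e` is a Heyting implication `a → b` in a preorder: `c ≤ e` iff `c ∧ a ≤ b`. -/
def IsHImp {α : Type u} [Preorder α] (a b e : α) : Prop :=
  ∀ c m : α, IsGLB {c, a} m → (c ≤ e ↔ m ≤ b)

/-- Heyting prealgebras: preorders having finite meets, finite joins and Heyting implications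
(that is, preorders whose poset reflection is a Heyting algebra). -/
structure IsHeytingPrealgebra (α : Type u) [Preorder α] : Prop where
  exists_top : ∃ t : α, IsTop t
  exists_bot : ∃ t : α, IsBot t
  exists_inf : ∀ a b : α, ∃ m, IsGLB {a, b} m
  exists_sup : ∀ a b : α, ∃ m, IsLUB {a, b} m
  exists_himp : ∀ a b : α, ∃ e, IsHImp a b e

/-- Morphisms of Heyting prealgebras: monotone maps preserving finite meets, finite joins and
implications. -/
structure IsHeytingPrealgebraHom {α : Type u} {β : Type v} [Preorder α] [Preorder β]
    (f : α → β) : Prop where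
  monotone : Monotone f
  map_top : ∀ t, IsTop t → IsTop (f t)
  map_bot : ∀ t, IsBot t → IsBot (f t)
  map_inf : ∀ a b m, IsGLB {a, b} m → IsGLB {f a, f b} (f m)
  map_sup : ∀ a b m, IsLUB {a, b} m → IsLUB {f a, f b} (f m)
  map_himp : ∀ a b e, IsHImp a b e → IsHImp (f a) (f b) (f e)

/-- A tripos over `Set`: a pseudofunctor from `Setᵒᵖ` to Heyting prealgebras whose reindexing maps
have both adjoints, satisfying the Beck-Chevalley condition, together with the existence of a
generic element. Isomorphism in a preorder is `AntisymmRel (· ≤ ·)`. -/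
structure Tripos where
  /-- the predicates on a set -/
  obj : Type u → Type u
  [preorder : ∀ X, Preorder (obj X)]
  heyting : ∀ X, IsHeytingPrealgebra (obj X)
  /-- reindexing along a function -/
  map : ∀ {X Y : Type u}, (X → Y) → obj Y → obj X
  map_hom : ∀ {X Y : Type u} (f : X → Y), IsHeytingPrealgebraHom (map f)
  map_id : ∀ {X : Type u} (φ : obj X), AntisymmRel (· ≤ ·) (map id φ) φ
  map_comp : ∀ {X Y Z : Type u} (f : X → Y) (g : Y → Z) (φ : obj Z),
    AntisymmRel (· ≤ ·) (map (g ∘ f) φ) (map f (map g φ))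
  /-- existential quantification along a function -/
  ex : ∀ {X Y : Type u}, (X → Y) → obj X → obj Y
  /-- universal quantification along a function -/
  all : ∀ {X Y : Type u}, (X → Y) → obj X → obj Y
  ex_adj : ∀ {X Y : Type u} (f : X → Y), GaloisConnection (ex f) (map f)
  all_adj : ∀ {X Y : Type u} (f : X → Y), GaloisConnection (map f) (all f)
  /-- Beck-Chevalley: the hypotheses say that `f, g, h, k` form a pullback square. -/
  beckChevalley : ∀ {X Y Z W : Type u} (f : X → Y) (g : X → Z) (h : Y → W) (k : Z → W),
    (∀ x, h (f x) = k (g x)) → (∀ y z, h y = k z → ∃! x, f x = y ∧ g x = z) →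
    ∀ φ : obj Y, AntisymmRel (· ≤ ·) (map k (all h φ)) (all g (map f φ))
  exists_generic : ∃ (S : Type u) (σ : obj S), ∀ (X : Type u) (φ : obj X),
    ∃ c : X → S, AntisymmRel (· ≤ ·) φ (map c σ)

namespace Tripos

attribute [instance] Tripos.preorder

end Tripos

/-- Transformations of triposes: families of monotone maps, natural up to isomorphism. -/
structure TriposTransformation (P Q : Tripos.{u}) where
  /-- the components -/
  app : ∀ X : Type u, P.obj X → Q.obj X
  monotone : ∀ X, Monotone (app X)
  natural : ∀ {X Y : Type u} (f : X → Y) (φ : P.obj Y),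
    AntisymmRel (· ≤ ·) (app X (P.map f φ)) (Q.map f (app Y φ))

/-- A transformation is cartesian if its components preserve finite meets. -/
structure TriposTransformation.IsCartesian {P Q : Tripos.{u}} (Φ : TriposTransformation P Q) :
    Prop where
  map_top : ∀ X t, IsTop t → IsTop (Φ.app X t)
  map_inf : ∀ X a b m, IsGLB {a, b} m → IsGLB {Φ.app X a, Φ.app X b} (Φ.app X m)

/-- Geometric morphisms `Q → P` of triposes: a cartesian transformation `P → Q` (inverse image)
with a right adjoint transformation `Q → P` (direct image). -/
structure GeometricMorphism (Q P : Tripos.{u}) where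
  /-- the inverse image -/
  inverse : TriposTransformation P Q
  /-- the direct image -/
  direct : TriposTransformation Q P
  cartesian : inverse.IsCartesian
  adj : ∀ X, GaloisConnection (inverse.app X) (direct.app X)

namespace GeometricMorphism

/-- Geometric inclusions: the direct image reflects the order. -/
def IsInclusion {Q P : Tripos.{u}} (Φ : GeometricMorphism Q P) : Prop :=
  ∀ (X : Type u) (a b : Q.obj X), Φ.direct.app X a ≤ Φ.direct.app X b → a ≤ b

/-- The identity geometric morphism. -/
def refl (P : Tripos.{u}) : GeometricMorphism P P where
  inverse := ⟨fun _ φ => φ, fun _ => monotone_id, fun _ _ => AntisymmRel.refl _ _⟩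
  direct := ⟨fun _ φ => φ, fun _ => monotone_id, fun _ _ => AntisymmRel.refl _ _⟩
  cartesian := ⟨fun _ _ h => h, fun _ _ _ _ h => h⟩
  adj _ := GaloisConnection.id

/-- Composition of geometric morphisms `R → Q → P`. -/
def comp {R Q P : Tripos.{u}} (Φ : GeometricMorphism Q P) (Θ : GeometricMorphism R Q) :
    GeometricMorphism R P where
  inverse := ⟨fun X φ => Θ.inverse.app X (Φ.inverse.app X φ),
    fun X => (Θ.inverse.monotone X).comp (Φ.inverse.monotone X),
    fun f φ => ((Φ.inverse.natural f φ).image (Θ.inverse.monotone _)).trans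
      (Θ.inverse.natural f _)⟩
  direct := ⟨fun X φ => Φ.direct.app X (Θ.direct.app X φ),
    fun X => (Φ.direct.monotone X).comp (Θ.direct.monotone X),
    fun f φ => ((Θ.direct.natural f φ).image (Φ.direct.monotone _)).trans
      (Φ.direct.natural f _)⟩
  cartesian := ⟨fun X t h => Θ.cartesian.map_top X _ (Φ.cartesian.map_top X t h),
    fun X a b m h => Θ.cartesian.map_inf X _ _ _ (Φ.cartesian.map_inf X a b m h)⟩
  adj X := (Φ.adj X).compose (Θ.adj X)

end GeometricMorphism

/-- Subtriposes of `P`: triposes with a geometric inclusion into `P`. -/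
structure Subtripos (P : Tripos.{u}) where
  /-- the domain of the inclusion -/
  tripos : Tripos.{u}
  /-- the inclusion -/
  incl : GeometricMorphism tripos P
  isInclusion : incl.IsInclusion

namespace Subtripos

variable {P : Tripos.{u}}

/-- `Φ ⊆ Ψ` iff `Φ` factors through `Ψ` by a geometric morphism, up to isomorphism. -/
instance : LE (Subtripos P) where
  le Φ Ψ := ∃ Θ : GeometricMorphism Φ.tripos Ψ.tripos, ∀ (X : Type u) (φ : Φ.tripos.obj X),
    AntisymmRel (· ≤ ·) (Φ.incl.direct.app X φ) ((Ψ.incl.comp Θ).direct.app X φ)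

instance : Preorder (Subtripos P) where
  le_refl Φ := ⟨GeometricMorphism.refl _, fun _ _ => AntisymmRel.refl _ _⟩
  le_trans := by
    rintro Φ Ψ Ξ ⟨Θ, h⟩ ⟨Θ', h'⟩
    exact ⟨Θ'.comp Θ, fun X φ => (h X φ).trans (h' X _)⟩

/-- The subtripos `Φ` is open, as witnessed by `α ∈ P(1)`: `Φ₊ Φ⁺ φ ≃ P(!)(α) → φ`. -/
def IsOpenWith (Φ : Subtripos P) (α : P.obj PUnit.{u + 1}) : Prop :=
  ∀ (X : Type u) (φ : P.obj X),
    IsHImp (P.map (fun _ => PUnit.unit) α) φ (Φ.incl.direct.app X (Φ.incl.inverse.app X φ))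

/-- The subtripos `Φ` is closed, as witnessed by `β ∈ P(1)`: `Φ₊ Φ⁺ φ ≃ φ ∨ P(!)(β)`. -/
def IsClosedWith (Φ : Subtripos P) (β : P.obj PUnit.{u + 1}) : Prop :=
  ∀ (X : Type u) (φ : P.obj X),
    IsLUB {φ, P.map (fun _ => PUnit.unit) β} (Φ.incl.direct.app X (Φ.incl.inverse.app X φ))

/-- `P` as a subtripos of itself is the largest subtripos. -/
instance : OrderTop (Subtripos P) where
  top := ⟨P, GeometricMorphism.refl P, fun _ _ _ h => h⟩
  le_top Φ := ⟨Φ.incl, fun _ _ => AntisymmRel.refl _ _⟩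

end Subtripos

/-- The degenerate tripos. -/
def Tripos.degenerate : Tripos.{u} where
  obj _ := PUnit.{u + 1}
  heyting _ :=
    { exists_top := ⟨⟨⟩, fun _ => le_rfl⟩
      exists_bot := ⟨⟨⟩, fun _ => le_rfl⟩
      exists_inf := fun _ _ => ⟨⟨⟩, fun _ _ => le_rfl, fun _ _ => le_rfl⟩
      exists_sup := fun _ _ => ⟨⟨⟩, fun _ _ => le_rfl, fun _ _ => le_rfl⟩
      exists_himp := fun _ _ => ⟨⟨⟩, fun _ _ _ => ⟨fun _ => le_rfl, fun _ => le_rfl⟩⟩ }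
  map _ φ := φ
  map_hom _ := ⟨monotone_id, fun _ h => h, fun _ h => h, fun _ _ _ h => h, fun _ _ _ h => h,
    fun _ _ _ h => h⟩
  map_id _ := AntisymmRel.refl _ _
  map_comp _ _ _ := AntisymmRel.refl _ _
  ex _ φ := φ
  all _ φ := φ
  ex_adj _ := GaloisConnection.id
  all_adj _ := GaloisConnection.id
  beckChevalley _ _ _ _ _ _ _ := AntisymmRel.refl _ _
  exists_generic := ⟨PUnit, ⟨⟩, fun _ _ => ⟨fun _ => ⟨⟩, AntisymmRel.refl _ _⟩⟩

namespace Subtripos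

variable {P : Tripos.{u}}

/-- The degenerate subtripos, whose direct image picks the top predicates. -/
noncomputable def degenerate (P : Tripos.{u}) : Subtripos P where
  tripos := Tripos.degenerate
  incl :=
    { inverse := ⟨fun _ _ => PUnit.unit, fun _ _ _ _ => le_rfl, fun _ _ => AntisymmRel.refl _ _⟩
      direct := ⟨fun X _ => (P.heyting X).exists_top.choose, fun _ _ _ _ => le_rfl, fun f _ =>
        ⟨(P.map_hom f).map_top _ (P.heyting _).exists_top.choose_spec _,
          (P.heyting _).exists_top.choose_spec _⟩⟩
      cartesian := ⟨fun _ _ _ _ => le_rfl, fun _ _ _ _ _ => ⟨fun _ _ => le_rfl, fun _ _ => le_rfl⟩⟩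
      adj := fun X _ _ => ⟨fun _ => (P.heyting X).exists_top.choose_spec _, fun _ => le_rfl⟩ }
  isInclusion _ _ _ _ := le_rfl

theorem direct_isTop (Φ : Subtripos P) (X : Type u) (t : Φ.tripos.obj X) (ht : IsTop t) :
    IsTop (Φ.incl.direct.app X t) := fun _ => (Φ.incl.adj X _ _).1 (ht _)

/-- The degenerate subtripos is the smallest subtripos. -/
noncomputable instance : OrderBot (Subtripos P) where
  bot := degenerate P
  bot_le Φ := ⟨(degenerate Φ.tripos).incl, fun X _ =>
    ⟨Φ.direct_isTop X _ (Φ.tripos.heyting X).exists_top.choose_spec _,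
      (P.heyting X).exists_top.choose_spec _⟩⟩

end Subtripos

/-- The poset of subtriposes of `P` up to equivalence, i.e. the poset reflection of the preorder
of subtriposes. -/
abbrev SubtriposClass (P : Tripos.{u}) : Type (u + 1) :=
  Antisymmetrization (Subtripos P) (· ≤ ·)

/-- The class of a subtripos up to equivalence. -/
abbrev Subtripos.toClass {P : Tripos.{u}} (Φ : Subtripos P) : SubtriposClass P :=
  toAntisymmetrization (· ≤ ·) Φ

noncomputable instance (P : Tripos.{u}) : BoundedOrder (SubtriposClass P) where
  top := (⊤ : Subtripos P).toClass
  bot := (⊥ : Subtripos P).toClass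
  le_top x := Quotient.inductionOn x fun Φ => (le_top : Φ ≤ ⊤)
  bot_le x := Quotient.inductionOn x fun Φ => (bot_le : ⊥ ≤ Φ)

/-! ## The arrow tripos -/

namespace ArrowAlgebra

/-- Predicates on a set `I` with values in an arrow algebra. -/
def Pred (A : ArrowAlgebra.{u}) (I : Type v) : Type (max u v) := I → A.carrier

/-- The logical order on predicates. -/
instance (A : ArrowAlgebra.{u}) (I : Type v) : Preorder (A.Pred I) where
  le φ ψ := A.Entails φ ψ
  le_refl := Entails.refl
  le_trans _ _ _ := Entails.trans

section

variable {A : ArrowAlgebra.{u}} {I : Type v}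

theorem isGLB_conj (φ ψ : A.Pred I) :
    IsGLB {φ, ψ} (fun i => A.conj (φ i) (ψ i) : A.Pred I) := by
  refine ⟨?_, fun χ h => Entails.conj (h (Set.mem_insert _ _)) (h (Set.mem_insert_of_mem _ rfl))⟩
  rintro _ (rfl | rfl)
  exacts [conj_left _ _, conj_right _ _]

theorem isLUB_plus (φ ψ : A.Pred I) :
    IsLUB {φ, ψ} (fun i => A.plus (φ i) (ψ i) : A.Pred I) := by
  refine ⟨?_, fun χ h => Entails.plus (h (Set.mem_insert _ _)) (h (Set.mem_insert_of_mem _ rfl))⟩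
  rintro _ (rfl | rfl)
  exacts [plus_left _ _, plus_right _ _]

theorem isHImp_imp (φ ψ : A.Pred I) :
    IsHImp φ ψ (fun i => A.imp (φ i) (ψ i) : A.Pred I) := by
  intro χ m hm
  have h := (isGLB_conj χ φ)
  exact ⟨fun h1 => (h.2 hm.1).trans (Entails.uncurry h1),
    fun h1 => Entails.curry (Entails.trans (hm.2 h.1) h1)⟩

theorem isTop_top : IsTop (α := A.Pred I) fun _ => ⊤ := fun _ => Entails.top _

theorem isBot_bot : IsBot (α := A.Pred I) fun _ => ⊥ := fun _ => Entails.of_le fun _ => bot_le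

end

theorem isHeytingPrealgebra_pred (A : ArrowAlgebra.{u}) (I : Type v) :
    IsHeytingPrealgebra (A.Pred I) where
  exists_top := ⟨_, isTop_top⟩
  exists_bot := ⟨_, isBot_bot⟩
  exists_inf φ ψ := ⟨_, isGLB_conj φ ψ⟩
  exists_sup φ ψ := ⟨_, isLUB_plus φ ψ⟩
  exists_himp φ ψ := ⟨_, isHImp_imp φ ψ⟩

/-- Reindexing of predicates. -/
def reindex (A : ArrowAlgebra.{u}) {I J : Type u} (f : J → I) (φ : A.Pred I) : A.Pred J :=
  fun j => φ (f j)

theorem reindex_monotone (A : ArrowAlgebra.{u}) {I J : Type u} (f : J → I) :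
    Monotone (A.reindex f) := fun _ _ h => Entails.reindex h f

theorem isGLB_congr {α : Type u} [Preorder α] {s : Set α} {a b : α} (h : IsGLB s a)
    (hab : AntisymmRel (· ≤ ·) a b) : IsGLB s b :=
  ⟨fun _ hx => hab.2.trans (h.1 hx), fun _ hx => (h.2 hx).trans hab.1⟩

theorem isLUB_congr {α : Type u} [Preorder α] {s : Set α} {a b : α} (h : IsLUB s a)
    (hab : AntisymmRel (· ≤ ·) a b) : IsLUB s b :=
  ⟨fun _ hx => (h.1 hx).trans hab.1, fun _ hx => hab.2.trans (h.2 hx)⟩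

theorem isGLB_antisymm {α : Type u} [Preorder α] {s : Set α} {a b : α} (h : IsGLB s a)
    (h' : IsGLB s b) : AntisymmRel (· ≤ ·) a b := ⟨h'.2 h.1, h.2 h'.1⟩

theorem isLUB_antisymm {α : Type u} [Preorder α] {s : Set α} {a b : α} (h : IsLUB s a)
    (h' : IsLUB s b) : AntisymmRel (· ≤ ·) a b := ⟨h.2 h'.1, h'.2 h.1⟩

theorem isHImp_congr {α : Type u} [Preorder α] {a b e e' : α} (h : IsHImp a b e)
    (hab : AntisymmRel (· ≤ ·) e e') : IsHImp a b e' := fun c m hm =>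
  ⟨fun h1 => (h c m hm).1 (h1.trans hab.2), fun h1 => ((h c m hm).2 h1).trans hab.1⟩

theorem isHImp_antisymm {α : Type u} [Preorder α] (hα : IsHeytingPrealgebra α) {a b e e' : α}
    (h : IsHImp a b e) (h' : IsHImp a b e') : AntisymmRel (· ≤ ·) e e' := by
  obtain ⟨m, hm⟩ := hα.exists_inf e a
  obtain ⟨m', hm'⟩ := hα.exists_inf e' a
  exact ⟨(h' e m hm).2 ((h e m hm).1 le_rfl), (h e' m' hm').2 ((h' e' m' hm').1 le_rfl)⟩

theorem reindex_hom (A : ArrowAlgebra.{u}) {I J : Type u} (f : J → I) :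
    IsHeytingPrealgebraHom (A.reindex f) where
  monotone := A.reindex_monotone f
  map_top _ h _ := (isTop_top _).trans (A.reindex_monotone f (h fun _ => ⊤))
  map_bot _ h _ := (A.reindex_monotone f (h fun _ => ⊥)).trans (isBot_bot _)
  map_inf φ ψ _ h := isGLB_congr (isGLB_conj (A.reindex f φ) (A.reindex f ψ))
    ((isGLB_antisymm (isGLB_conj φ ψ) h).image (A.reindex_monotone f))
  map_sup φ ψ _ h := isLUB_congr (isLUB_plus (A.reindex f φ) (A.reindex f ψ))
    ((isLUB_antisymm (isLUB_plus φ ψ) h).image (A.reindex_monotone f))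
  map_himp φ ψ _ h := isHImp_congr (isHImp_imp (A.reindex f φ) (A.reindex f ψ))
    ((isHImp_antisymm (A.isHeytingPrealgebra_pred I) (isHImp_imp φ ψ) h).image
      (A.reindex_monotone f))

/-- Existential quantification:
`∃_f(α)(i) = ⋀ c, (⋀ j ∈ f⁻¹(i), α(j) → ∂c) → ∂∂c`. -/
def predEx (A : ArrowAlgebra.{u}) {J I : Type u} (f : J → I) (α : A.Pred J) : A.Pred I := fun i =>
  ⨅ c, A.imp (⨅ j : {j // f j = i}, A.imp (α j) (A.del c)) (A.del (A.del c))

/-- Universal quantification: `∀_f(α)(i) = ⋀ j ∈ f⁻¹(i), ∂α(j)`. -/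
def predAll (A : ArrowAlgebra.{u}) {J I : Type u} (f : J → I) (α : A.Pred J) : A.Pred I := fun i =>
  ⨅ j : {j // f j = i}, A.del (α j)

theorem predEx_adj (A : ArrowAlgebra.{u}) {J I : Type u} (f : J → I) :
    GaloisConnection (A.predEx f) (A.reindex f) := by
  intro α β
  constructor
  · intro h
    refine Entails.trans (y := fun j => A.predEx f α (f j)) ?_ (Entails.reindex h f)
    refine entails_iInf (κ := fun _ => A.carrier) ?_
    refine Entails.trans (Entails.curry (x := fun p : (Σ' _ : J, A.carrier) =>
      A.imp (α p.1) (A.del p.2)) (y := fun p => A.del (A.del p.2)) ?_) (Entails.of_le fun p =>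
        A.imp_mono (iInf_le_of_le ⟨p.1, rfl⟩ le_rfl) le_rfl)
    exact (Entails.app (conj_right _ _) (conj_left _ _)).trans (entails_del _)
  · intro h
    refine Entails.trans (.of_le fun i => iInf_le _ (β i)) (Entails.trans (Valid.elim ?_)
      (del_entails β))
    have h' : A.Entails α fun j => A.del (β (f j)) := Entails.trans h (entails_del _)
    refine A.sep_upward h' (le_iInf fun i => le_iInf ?_)
    rintro ⟨j, rfl⟩
    exact iInf_le (fun j => A.imp (α j) (A.del (β (f j)))) j

theorem predAll_adj (A : ArrowAlgebra.{u}) {J I : Type u} (f : J → I) :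
    GaloisConnection (A.reindex f) (A.predAll f) := by
  intro α β
  constructor
  · intro h
    refine entails_iInf (κ := fun i => {j // f j = i}) ?_
    have h' : A.Entails (fun j => α (f j)) fun j => A.del (β j) := Entails.trans h (entails_del _)
    refine A.sep_upward h' (le_iInf ?_)
    rintro ⟨i, j, rfl⟩
    exact iInf_le (fun j => A.imp (α (f j)) (A.del (β j))) j
  · intro h
    refine Entails.trans (Entails.reindex h f) (Entails.trans (.of_le fun j => ?_) (del_entails β))
    exact iInf_le (fun k : {k // f k = f j} => A.del (β k)) ⟨j, rfl⟩

/-- The arrow tripos `P_A`, with `P_A(I) = (I → A, ⊢_I)` and reindexing by precomposition. -/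
def tripos (A : ArrowAlgebra.{u}) : Tripos.{u} where
  obj I := A.Pred I
  heyting := A.isHeytingPrealgebra_pred
  map f φ := A.reindex f φ
  map_hom f := A.reindex_hom f
  map_id _ := AntisymmRel.refl _ _
  map_comp _ _ _ := AntisymmRel.refl _ _
  ex f α := A.predEx f α
  all f α := A.predAll f α
  ex_adj f := A.predEx_adj f
  all_adj f := A.predAll_adj f
  beckChevalley f g h k hc hp φ := by
    refine AntisymmRel.of_eq (funext fun z => le_antisymm (le_iInf ?_) (le_iInf ?_))
    · rintro ⟨x, rfl⟩
      exact iInf_le (fun y : {y // h y = k (g x)} => A.del (φ y)) ⟨f x, hc x⟩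
    · rintro ⟨y, hy⟩
      obtain ⟨x, ⟨rfl, hx⟩, -⟩ := hp y z hy
      exact iInf_le (fun x : {x // g x = z} => A.del (φ (f x))) ⟨x, hx⟩
  exists_generic := ⟨A.carrier, fun a => a, fun _ φ => ⟨φ, AntisymmRel.refl _ _⟩⟩

end ArrowAlgebra

/-! ## Implicative morphisms -/

/-- Implicative morphisms of arrow algebras. -/
structure ImplicativeMorphism (A B : ArrowAlgebra.{u}) where
  /-- the underlying function -/
  toFun : A.carrier → B.carrier
  map_sep : ∀ a ∈ A.sep, toFun a ∈ B.sep
  exists_realizer : ∃ r ∈ B.sep, ∀ a a' : A.carrier,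
    r ≤ B.imp (toFun (A.imp a a')) (B.imp (toFun a) (toFun a'))
  map_iInf_imp : ∀ X : Set (A.carrier × A.carrier),
    (⨅ p ∈ X, A.imp p.1 p.2) ∈ A.sep → (⨅ p ∈ X, B.imp (toFun p.1) (toFun p.2)) ∈ B.sep

namespace ImplicativeMorphism

open ArrowAlgebra

variable {A B : ArrowAlgebra.{u}}

/-- Monotone functions satisfying the first two conditions are implicative morphisms. -/
def ofMonotone (f : A.carrier → B.carrier) (hf : Monotone f) (h1 : ∀ a ∈ A.sep, f a ∈ B.sep)
    (h2 : ∃ r ∈ B.sep, ∀ a a' : A.carrier, r ≤ B.imp (f (A.imp a a')) (B.imp (f a) (f a'))) :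
    ImplicativeMorphism A B where
  toFun := f
  map_sep := h1
  exists_realizer := h2
  map_iInf_imp X hX := by
    obtain ⟨r, hr, h⟩ := h2
    rw [iInf_subtype'] at hX ⊢
    have h3 : B.Valid fun p : X => B.imp (f (A.imp p.1.1 p.1.2)) (B.imp (f p.1.1) (f p.1.2)) :=
      B.sep_upward hr (le_iInf fun _ => h _ _)
    exact h3.mp (B.sep_upward (h1 _ hX) (le_iInf fun p =>
      hf (iInf_le (fun p : X => A.imp p.1.1 p.1.2) p)))

theorem entails (f : ImplicativeMorphism A B) {I : Type v} {φ ψ : I → A.carrier}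
    (h : A.Entails φ ψ) : B.Entails (fun i => f.toFun (φ i)) fun i => f.toFun (ψ i) := by
  have := f.map_iInf_imp (Set.range fun i => (φ i, ψ i)) (by rwa [iInf_range])
  rwa [iInf_range] at this

/-- The transformation of arrow triposes induced by an implicative morphism. -/
def transformation (f : ImplicativeMorphism A B) : TriposTransformation A.tripos B.tripos where
  app _ φ := fun i => f.toFun (φ i)
  monotone _ _ _ h := f.entails h
  natural _ _ := AntisymmRel.refl _ _

theorem isCartesian (f : ImplicativeMorphism A B) : f.transformation.IsCartesian where
  map_top X t h := by
    have h1 : A.Entails (fun _ => ⊤) t := h fun _ => ⊤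
    have h2 := f.entails h1
    have h3 : f.toFun ⊤ ∈ B.sep := f.map_sep _ (A.sep_upward h1 le_top)
    intro χ
    have h4 : B.Valid fun _ : X => f.toFun ⊤ := B.sep_upward h3 (le_iInf fun _ => le_rfl)
    exact Entails.trans h4.weaken h2
  map_inf X a b m h := by
    refine ⟨?_, fun χ hχ => ?_⟩
    · rintro _ (rfl | rfl)
      · exact f.entails (h.1 (Set.mem_insert _ _))
      · exact f.entails (h.1 (Set.mem_insert_of_mem _ rfl))
    · have h1 : A.Entails a fun i => A.imp (b i) (m i) :=
        Entails.curry (h.2 (isGLB_conj (A := A) a b).1)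
      have h2 := f.entails h1
      obtain ⟨r, hr, hf⟩ := f.exists_realizer
      have h3 : B.Entails (fun i => f.toFun (A.imp (b i) (m i)))
          fun i => B.imp (f.toFun (b i)) (f.toFun (m i)) :=
        B.sep_upward hr (le_iInf fun _ => hf _ _)
      have h4 : B.Entails χ fun i => f.toFun (a i) := hχ (Set.mem_insert _ _)
      have h5 : B.Entails χ fun i => f.toFun (b i) := hχ (Set.mem_insert_of_mem _ rfl)
      exact Entails.app (h4.trans (h2.trans h3)) h5

/-- `h` is right adjoint to `f`: `f h ⊢ id` and `id ⊢ h f`. -/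
structure IsRightAdjoint (f : ImplicativeMorphism A B) (h : ImplicativeMorphism B A) : Prop where
  counit : B.Entails (fun b => f.toFun (h.toFun b)) fun b => b
  unit : A.Entails (fun a => a) fun a => h.toFun (f.toFun a)

/-- The geometric morphism `P_B → P_A` induced by a (computationally dense) implicative morphism
`f : A → B` with right adjoint `h`. -/
def geometricMorphism (f : ImplicativeMorphism A B) (h : ImplicativeMorphism B A)
    (hfh : f.IsRightAdjoint h) : GeometricMorphism B.tripos A.tripos where
  inverse := f.transformation
  direct := h.transformation
  cartesian := f.isCartesian
  adj _ φ ψ := ⟨fun h1 => Entails.trans (Entails.reindex hfh.unit φ) (h.entails h1),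
    fun h1 => Entails.trans (f.entails h1) (Entails.reindex hfh.counit ψ)⟩

/-- The subtripos `P_B ↪ P_A` induced by `f : A → B` with right adjoint `h` such that
`id ⊢ f h`. -/
def subtripos (f : ImplicativeMorphism A B) (h : ImplicativeMorphism B A)
    (hfh : f.IsRightAdjoint h) (hs : B.Entails (fun b => b) fun b => f.toFun (h.toFun b)) :
    Subtripos A.tripos where
  tripos := B.tripos
  incl := f.geometricMorphism h hfh
  isInclusion _ φ ψ h1 := Entails.trans (Entails.reindex hs φ)
    (Entails.trans (f.entails h1) (Entails.reindex hfh.counit ψ))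

end ImplicativeMorphism

/-! ## Nuclei -/

namespace ArrowAlgebra

/-- Nuclei on an arrow algebra. -/
structure Nucleus (A : ArrowAlgebra.{u}) where
  /-- the underlying function -/
  toFun : A.carrier → A.carrier
  monotone : Monotone toFun
  unit_mem : (⨅ a, A.imp a (toFun a)) ∈ A.sep
  bind_mem : (⨅ (a) (b), A.imp (A.imp a (toFun b)) (A.imp (toFun a) (toFun b))) ∈ A.sep

namespace Nucleus

variable {A : ArrowAlgebra.{u}} {I : Sort v} (j : A.Nucleus)

theorem unit (x : I → A.carrier) : A.Entails x fun i => j.toFun (x i) :=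
  A.sep_upward j.unit_mem (le_iInf fun _ => iInf_le _ _)

theorem bind {g x y : I → A.carrier} (hx : A.Entails g fun i => j.toFun (x i))
    (h : A.Entails (fun i => A.conj (g i) (x i)) fun i => j.toFun (y i)) :
    A.Entails g fun i => j.toFun (y i) := by
  have h1 : A.Entails (fun i => A.imp (x i) (j.toFun (y i)))
      fun i => A.imp (j.toFun (x i)) (j.toFun (y i)) :=
    A.sep_upward j.bind_mem (le_iInf fun i => (iInf_le _ (x i)).trans (iInf_le _ (y i)))
  exact Entails.app ((Entails.curry h).trans h1) hx

theorem app {g x y : I → A.carrier}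
    (h : A.Entails g fun i => j.toFun (A.imp (x i) (j.toFun (y i))))
    (hx : A.Entails g fun i => j.toFun (x i)) : A.Entails g fun i => j.toFun (y i) :=
  j.bind h (j.bind ((conj_left _ _).trans hx)
    (Entails.app ((conj_left _ _).trans (conj_right _ _)) (conj_right _ _)))

theorem mem_of_entails {x : A.carrier} (h : A.Entails (fun _ : PUnit.{1} => ⊤) fun _ => x) :
    x ∈ A.sep :=
  A.sep_mp (A.sep_upward h (iInf_le _ PUnit.unit)) (A.sep_upward A.sep_k le_top)

theorem entails_of_mem {x : A.carrier} (h : x ∈ A.sep) (g : I → A.carrier) :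
    A.Entails g fun _ => x :=
  Valid.weaken (A.sep_upward h (le_iInf fun _ => le_rfl))

theorem mem_of_mem {x : A.carrier} (h : x ∈ A.sep) : j.toFun x ∈ A.sep :=
  mem_of_entails ((entails_of_mem h _).trans (j.unit _))

theorem imp_entails_imp {j : A.Nucleus} {g x y : I → A.carrier}
    (h : A.Entails (fun i => A.conj (g i) (x i)) fun i => j.toFun (y i)) :
    A.Entails g fun i => j.toFun (A.imp (x i) (j.toFun (y i))) :=
  (Entails.curry h).trans (j.unit _)

/-- The arrow algebra `A_j = (A, ≤, →_j, S_j)` with `a →_j b := a → j b` and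
`S_j := {a | j a ∈ S}`. -/
def quotient (A : ArrowAlgebra.{u}) (j : A.Nucleus) : ArrowAlgebra.{u} where
  carrier := A.carrier
  lattice := A.lattice
  imp a b := A.imp a (j.toFun b)
  imp_mono ha hb := A.imp_mono ha (j.monotone hb)
  sep := {a | j.toFun a ∈ A.sep}
  sep_upward ha hab := A.sep_upward ha (j.monotone hab)
  sep_mp hab ha := mem_of_entails (j.app (entails_of_mem hab _) (entails_of_mem ha _))
  sep_k := by
    refine j.mem_of_mem ?_
    have h : A.Entails (fun p : A.carrier × A.carrier => p.1)
        fun p => j.toFun (A.imp p.2 (j.toFun p.1)) :=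
      imp_entails_imp ((conj_left _ _).trans (j.unit _))
    refine A.sep_upward h (le_iInf fun a => le_iInf fun b => ?_)
    exact iInf_le (fun p : A.carrier × A.carrier =>
      A.imp p.1 (j.toFun (A.imp p.2 (j.toFun p.1)))) (a, b)
  sep_s := by
    refine j.mem_of_mem ?_
    have h : A.Entails (fun p : A.carrier × A.carrier × A.carrier =>
          A.imp p.1 (j.toFun (A.imp p.2.1 (j.toFun p.2.2))))
        fun p => j.toFun (A.imp (A.imp p.1 (j.toFun p.2.1))
          (j.toFun (A.imp p.1 (j.toFun p.2.2)))) := by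
      refine imp_entails_imp (imp_entails_imp ?_)
      refine j.app (x := fun p => p.2.1) ?_ ?_
      · exact Entails.app ((conj_left _ _).trans (conj_left _ _)) (conj_right _ _)
      · exact Entails.app ((conj_left _ _).trans (conj_right _ _)) (conj_right _ _)
    refine A.sep_upward h (le_iInf fun a => le_iInf fun b => le_iInf fun c => ?_)
    exact iInf_le_of_le (a, b, c) le_rfl
  sep_a := by
    refine j.mem_of_mem ?_
    let T : Type (u + 1) :=
      A.carrier × (Σ I : Type u, (I → A.carrier) × (I → A.carrier))
    have h : A.Entails (fun p : T => ⨅ i, A.imp p.1 (j.toFun (A.imp (p.2.2.1 i)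
          (j.toFun (p.2.2.2 i)))))
        fun p => j.toFun (A.imp p.1 (j.toFun (⨅ i, A.imp (p.2.2.1 i)
          (j.toFun (p.2.2.2 i))))) := by
      refine imp_entails_imp (Entails.trans ?_ (j.unit _))
      refine entails_iInf (κ := fun p : T => p.2.1) (Entails.curry ?_)
      refine j.app (x := fun q => q.1.2.2.1 q.2) ?_ ((conj_right _ _).trans (j.unit _))
      refine Entails.app (x := fun q => q.1.1) ?_ ((conj_left _ _).trans (conj_right _ _))
      refine ((conj_left _ _).trans (conj_left _ _)).trans (.of_le fun q => ?_)
      exact iInf_le _ q.2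
    refine A.sep_upward h (le_iInf fun a => le_iInf fun I => le_iInf fun b => le_iInf fun c => ?_)
    exact iInf_le_of_le (a, ⟨I, b, c⟩) le_rfl

/-- The identity as an implicative morphism `A → A_j`. -/
def toQuotient : ImplicativeMorphism A (quotient A j) :=
  .ofMonotone (fun a => a) (fun _ _ h => h) (fun _ h => j.mem_of_mem h) <| by
    have h : A.Entails (fun p : A.carrier × A.carrier => A.imp p.1 p.2)
        fun p => j.toFun (A.imp p.1 (j.toFun p.2)) :=
      imp_entails_imp ((Entails.uncurry (Entails.refl _)).trans (j.unit _))
    exact ⟨_, j.mem_of_mem h, fun a a' => iInf_le (fun p : A.carrier × A.carrier =>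
      A.imp (A.imp p.1 p.2) (j.toFun (A.imp p.1 (j.toFun p.2)))) (a, a')⟩

/-- The function `j` as an implicative morphism `A_j → A`. -/
def fromQuotient : ImplicativeMorphism (quotient A j) A :=
  .ofMonotone j.toFun j.monotone (fun _ h => h) <| by
    have h : A.Entails (fun p : A.carrier × A.carrier => j.toFun (A.imp p.1 (j.toFun p.2)))
        fun p => A.imp (j.toFun p.1) (j.toFun p.2) :=
      Entails.curry (j.app (conj_left _ _) (conj_right _ _))
    exact ⟨_, h, fun a a' => iInf_le (fun p : A.carrier × A.carrier =>
      A.imp (j.toFun (A.imp p.1 (j.toFun p.2))) (A.imp (j.toFun p.1) (j.toFun p.2))) (a, a')⟩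

theorem entails_quotient {x y : I → A.carrier} (h : A.Entails x fun i => j.toFun (y i)) :
    (quotient A j).Entails x y := j.mem_of_mem h

theorem isRightAdjoint : j.toQuotient.IsRightAdjoint j.fromQuotient where
  counit := j.entails_quotient (Entails.refl _)
  unit := j.unit _

/-- The subtripos `P_{A_j} ↪ P_A` induced by a nucleus `j`, with inverse image `id ∘ -` and
direct image `j ∘ -`. -/
def subtripos : Subtripos A.tripos :=
  j.toQuotient.subtripos j.fromQuotient j.isRightAdjoint
    (j.entails_quotient ((j.unit _).trans (j.unit _)))

end Nucleus

/-- The open nucleus `o(x) := u → x`. -/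
def openNucleus (A : ArrowAlgebra.{u}) (u : A.carrier) : A.Nucleus where
  toFun x := A.imp u x
  monotone _ _ h := A.imp_mono le_rfl h
  unit_mem := entails_k (fun a : A.carrier => a) _
  bind_mem := by
    have h : A.Entails (fun p : A.carrier × A.carrier => A.imp p.1 (A.imp u p.2))
        fun p => A.imp (A.imp u p.1) (A.imp u p.2) := by
      refine Entails.curry (Entails.curry ?_)
      exact Entails.app (Entails.app ((conj_left _ _).trans (conj_left _ _))
        (Entails.app ((conj_left _ _).trans (conj_right _ _)) (conj_right _ _))) (conj_right _ _)
    refine A.sep_upward h (le_iInf fun a => le_iInf fun b => ?_)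
    exact iInf_le_of_le (a, b) le_rfl

/-- The closed nucleus `c(x) := x + u`. -/
def closedNucleus (A : ArrowAlgebra.{u}) (u : A.carrier) : A.Nucleus where
  toFun x := A.plus x u
  monotone _ _ h := iInf_mono fun _ => A.imp_mono (A.imp_mono h le_rfl) le_rfl
  unit_mem := plus_left (fun a : A.carrier => a) _
  bind_mem := by
    have h : A.Entails (fun p : A.carrier × A.carrier => A.imp p.1 (A.plus p.2 u))
        fun p => A.imp (A.plus p.1 u) (A.plus p.2 u) :=
      Entails.flip (Entails.plus (Entails.flip (Entails.refl _))
        ((plus_right _ _).trans (entails_k _ _)))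
    refine A.sep_upward h (le_iInf fun a => le_iInf fun b => ?_)
    exact iInf_le_of_le (a, b) le_rfl

end ArrowAlgebra

/-! ## The Sierpiński construction and the modification -/

/-- Pairs `(x₀, x₁)` with `x₀ ≤ x₁`, ordered pointwise. -/
abbrev ArrowPairs (α : Type u) [LE α] : Type u := {x : α × α // x.1 ≤ x.2}

namespace ArrowPairs

variable {α : Type u} [CompleteLattice α]

instance : InfSet (ArrowPairs α) where
  sInf s := ⟨(⨅ x ∈ s, x.1.1, ⨅ x ∈ s, x.1.2), iInf₂_mono fun x _ => x.2⟩

/-- Meets of pairs are computed pointwise. -/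
instance : CompleteLattice (ArrowPairs α) :=
  completeLatticeOfInf (ArrowPairs α) fun _ =>
    ⟨fun x hx => ⟨iInf₂_le x hx, iInf₂_le x hx⟩,
      fun _ hy => ⟨le_iInf₂ fun _ hx => (hy hx).1, le_iInf₂ fun _ hx => (hy hx).2⟩⟩

theorem fst_iInf {I : Sort v} (x : I → ArrowPairs α) : (⨅ i, x i).1.1 = ⨅ i, (x i).1.1 := by
  change ⨅ y ∈ Set.range x, y.1.1 = _
  rw [iInf_range]

theorem snd_iInf {I : Sort v} (x : I → ArrowPairs α) : (⨅ i, x i).1.2 = ⨅ i, (x i).1.2 := by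
  change ⨅ y ∈ Set.range x, y.1.2 = _
  rw [iInf_range]

end ArrowPairs

namespace ArrowAlgebra

/-- The implication on pairs: `x → y := (x₀ → y₀ ∧ x₁ → y₁, x₁ → y₁)`. -/
def pairImp (A : ArrowAlgebra.{u}) (x y : ArrowPairs A.carrier) : ArrowPairs A.carrier :=
  ⟨(A.imp x.1.1 y.1.1 ⊓ A.imp x.1.2 y.1.2, A.imp x.1.2 y.1.2), inf_le_right⟩

theorem pairImp_mono (A : ArrowAlgebra.{u}) {x x' y y' : ArrowPairs A.carrier} (hx : x' ≤ x)
    (hy : y ≤ y') : A.pairImp x y ≤ A.pairImp x' y' :=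
  ⟨inf_le_inf (A.imp_mono hx.1 hy.1) (A.imp_mono hx.2 hy.2), A.imp_mono hx.2 hy.2⟩

theorem BinaryImplicative.le_imp {A : ArrowAlgebra.{u}} (hA : A.BinaryImplicative)
    {r a : A.carrier} {x y : ArrowPairs A.carrier} (h0 : r ≤ A.imp a (A.imp x.1.1 y.1.1))
    (h1 : r ≤ A.imp a (A.imp x.1.2 y.1.2)) : r ≤ A.imp a (A.pairImp x y).1.1 :=
  (le_inf h0 h1).trans (hA _ _ _).ge

/-- The Sierpiński construction: the arrow algebra `A^→` of pairs `(x₀, x₁)`, `x₀ ≤ x₁`, over a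
binary implicative arrow algebra, with separator `{x | x₀ ∈ S}`. -/
def sierpinski (A : ArrowAlgebra.{u}) (hA : A.BinaryImplicative) : ArrowAlgebra.{u} where
  carrier := ArrowPairs A.carrier
  imp := A.pairImp
  imp_mono := A.pairImp_mono
  sep := {x | x.1.1 ∈ A.sep}
  sep_upward hx hxy := A.sep_upward hx hxy.1
  sep_mp hxy hx := A.sep_mp (A.sep_upward hxy inf_le_left) hx
  sep_k := by
    simp only [Set.mem_ofPred_eq, ArrowPairs.fst_iInf]
    refine A.sep_upward A.sep_k (le_iInf fun x => le_iInf fun y => ?_)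
    have hk : ∀ a b, (⨅ (a : A.carrier) (b : A.carrier), A.imp a (A.imp b a)) ≤
        A.imp a (A.imp b a) := fun a b => (iInf_le _ a).trans (iInf_le _ b)
    refine le_inf (hA.le_imp (hk _ _) ((hk _ y.1.2).trans (A.imp_mono x.2 le_rfl))) (hk _ _)
  sep_s := by
    simp only [Set.mem_ofPred_eq, ArrowPairs.fst_iInf]
    refine A.sep_upward A.sep_s (le_iInf fun x => le_iInf fun y => le_iInf fun z => ?_)
    have hs : ∀ a b c, (⨅ (a : A.carrier) (b : A.carrier) (c : A.carrier),
        A.imp (A.imp a (A.imp b c)) (A.imp (A.imp a b) (A.imp a c))) ≤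
        A.imp (A.imp a (A.imp b c)) (A.imp (A.imp a b) (A.imp a c)) := fun a b c =>
      iInf_le_of_le a (iInf_le_of_le b (iInf_le _ c))
    have h0 : (A.pairImp x (A.pairImp y z)).1.1 ≤ A.imp x.1.1 (A.imp y.1.1 z.1.1) :=
      inf_le_left.trans (A.imp_mono le_rfl inf_le_left)
    have h1 : (A.pairImp x (A.pairImp y z)).1.1 ≤ A.imp x.1.2 (A.imp y.1.2 z.1.2) := inf_le_right
    refine le_inf (hA.le_imp ?_ ?_) (hs _ _ _)
    · refine (le_inf ?_ ?_).trans ((A.imp_mono le_rfl (hA _ _ _).ge).trans' (hA _ _ _).ge)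
      · exact (hs _ _ _).trans (A.imp_mono h0 (A.imp_mono inf_le_left le_rfl))
      · exact (hs _ _ _).trans (A.imp_mono h1 (A.imp_mono inf_le_right le_rfl))
    · exact (hs _ _ _).trans (A.imp_mono h1 le_rfl)
  sep_a := by
    simp only [Set.mem_ofPred_eq, ArrowPairs.fst_iInf]
    refine A.sep_upward A.sep_a
      (le_iInf fun x => le_iInf fun I => le_iInf fun y => le_iInf fun z => ?_)
    have ha : ∀ (a) (b c : I → A.carrier), (⨅ (a : A.carrier) (I : Type u) (b : I → A.carrier)
        (c : I → A.carrier), A.imp (⨅ i, A.imp a (A.imp (b i) (c i)))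
          (A.imp a (⨅ i, A.imp (b i) (c i)))) ≤
        A.imp (⨅ i, A.imp a (A.imp (b i) (c i))) (A.imp a (⨅ i, A.imp (b i) (c i))) :=
      fun a b c => iInf_le_of_le a (iInf_le_of_le I (iInf_le_of_le b (iInf_le _ c)))
    have h0 : (⨅ i, A.pairImp x (A.pairImp (y i) (z i))).1.1 ≤
        ⨅ i, A.imp x.1.1 (A.imp (y i).1.1 (z i).1.1) := by
      rw [ArrowPairs.fst_iInf]
      exact iInf_mono fun i => inf_le_left.trans (A.imp_mono le_rfl inf_le_left)
    have h1 : (⨅ i, A.pairImp x (A.pairImp (y i) (z i))).1.1 ≤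
        ⨅ i, A.imp x.1.2 (A.imp (y i).1.2 (z i).1.2) := by
      rw [ArrowPairs.fst_iInf]
      exact iInf_mono fun i => inf_le_right
    have e0 : (⨅ i, A.pairImp (y i) (z i)).1.1 =
        (⨅ i, A.imp (y i).1.1 (z i).1.1) ⊓ ⨅ i, A.imp (y i).1.2 (z i).1.2 := by
      rw [ArrowPairs.fst_iInf, ← iInf_inf_eq]
      rfl
    have e1 : (⨅ i, A.pairImp (y i) (z i)).1.2 = ⨅ i, A.imp (y i).1.2 (z i).1.2 :=
      ArrowPairs.snd_iInf _
    refine le_inf (hA.le_imp ?_ ?_) ?_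
    · rw [e0, hA, hA]
      exact le_inf ((ha _ _ _).trans (A.imp_mono h0 le_rfl))
        ((ha _ _ _).trans (A.imp_mono h1 (A.imp_mono x.2 le_rfl)))
    · rw [e1]
      exact (ha _ _ _).trans (A.imp_mono h1 le_rfl)
    · change _ ≤ A.imp _ (A.imp _ (⨅ i, A.pairImp (y i) (z i)).1.2)
      rw [e1, ArrowPairs.snd_iInf]
      exact ha _ _ _

end ArrowAlgebra

namespace ArrowAlgebra

variable (A : ArrowAlgebra.{u}) (hA : A.BinaryImplicative)

/-- The second projection `π₁ : A^→ → A`, `(x₀, x₁) ↦ x₁`. -/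
def sndProj : ImplicativeMorphism (A.sierpinski hA) A :=
  .ofMonotone (fun x : ArrowPairs A.carrier => x.1.2) (fun _ _ h => h.2)
    (fun x hx => A.sep_upward hx x.2)
    ⟨_, Entails.refl (A := A) fun a => a, fun _ _ => iInf_le _ _⟩

/-- The diagonal `δ : A → A^→`, `a ↦ (a, a)`. -/
def diag : ImplicativeMorphism A (A.sierpinski hA) :=
  .ofMonotone (B := A.sierpinski hA) (fun a => ⟨(a, a), le_rfl⟩) (fun _ _ h => ⟨h, h⟩)
    (fun _ ha => ha) <| by
      refine ⟨(⟨(_, _), le_rfl⟩ : ArrowPairs A.carrier), Entails.refl (A := A) fun a => a, ?_⟩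
      intro a b
      have h : (⨅ x, A.imp x x) ≤ A.imp (A.imp a b) (A.imp a b) := iInf_le _ _
      have h' : (⨅ x, A.imp x x) ≤ A.imp (A.imp a b) (A.imp a b ⊓ A.imp a b) := by
        rwa [inf_idem]
      exact ⟨le_inf h' h, h⟩

theorem sndProj_isRightAdjoint : (A.sndProj hA).IsRightAdjoint (A.diag hA) where
  counit := Entails.refl _
  unit := by
    have h := Entails.refl (A := A) fun a => a
    change (iInf (α := ArrowPairs A.carrier) fun x => A.pairImp x ⟨(x.1.2, x.1.2), le_rfl⟩).1.1 ∈ A.sep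
    rw [ArrowPairs.fst_iInf]
    refine A.sep_upward h (le_iInf fun x => le_inf ?_ (iInf_le _ _))
    exact (iInf_le _ x.1.2).trans (A.imp_mono x.2 le_rfl)

/-- The inclusion `P_A ↪ P_{A^→}` induced by the second projection: its inverse image is
`π₁ ∘ -` and its direct image is `δ ∘ -`. -/
def sndInclusion : Subtripos (A.sierpinski hA).tripos :=
  (A.sndProj hA).subtripos (A.diag hA) (A.sndProj_isRightAdjoint hA) (Entails.refl _)

/-- The element `(⊥, ⊤)` of `A^→`. -/
def botTop : (A.sierpinski hA).carrier := ⟨((⊥ : A.carrier), (⊤ : A.carrier)), bot_le⟩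

variable {A}

/-- The modification `A^m := (A^→)_c` of a modifiable arrow algebra, for `c(x) := x + (⊥, ⊤)`. -/
def Modifiable.modification (hA : A.Modifiable) : ArrowAlgebra.{u} :=
  Nucleus.quotient (A.sierpinski hA.binaryImplicative)
    ((A.sierpinski hA.binaryImplicative).closedNucleus (A.botTop hA.binaryImplicative))

/-- The modified arrow tripos `M_A = P_{A^m}`, as a subtripos of `P_{A^→}`. -/
def Modifiable.modifiedTripos (hA : A.Modifiable) :
    Subtripos (A.sierpinski hA.binaryImplicative).tripos :=
  ((A.sierpinski hA.binaryImplicative).closedNucleus (A.botTop hA.binaryImplicative)).subtripos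

theorem Modifiable.modifiedTripos_tripos (hA : A.Modifiable) :
    hA.modifiedTripos.tripos = hA.modification.tripos := rfl

end ArrowAlgebra

/-! A subtripos `Φ` is determined up to equivalence by its closure operator `Φ₊ Φ⁺`, which is a
nucleus: natural in the set, inflationary, idempotent and preserving binary meets. Factorization is
the reversed pointwise order of nuclei (`Subtripos.le_iff_nucleus_le`). Conversely every nucleus `K`
on a tripos comes from a subtripos, with the same predicates and the order `φ ≤ K ψ`. The
proposition thus becomes Heyting algebra.

The open subtripos with witness `α` has nucleus `α → -`, the closed one `- ∨ α`. A nucleus above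
both sends every `φ` to a predicate above `α`, which is closed under `α → -`, hence top. A nucleus
below both sends `φ` to something below `φ ∨ α` and below `α → φ`, hence below `φ`. So the two
subtriposes are complements (`IsOpenWith.isCompl`).

For uniqueness, let `k` be the nucleus of a complement `Ξ` of the open subtripos. The order is only
known to be bounded, so disjointness and codisjointness must be tested on actual subtriposes, namely
those of the nuclei `α → k(-)` and `(α → -) ∧ k(-)`. The first test gives `α ≤ k φ` for all `φ`. The
second gives `(α → χ) ∧ k χ ≤ χ`, and `χ = φ ∨ α` yields `k φ ≤ φ ∨ α`. Hence `k` is `- ∨ α`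
(`IsOpenWith.eq_of_isCompl`).

For arrow algebras, the nuclei `o` and `c` compute Heyting implication and join by construction. The
one calculation is that `⊥ → a = ⊤` makes `(⊥, ⊤) → x` equal to the diagonal at `∂ x₁`, which is
logically equivalent to `δ (π₁ x)`. -/

/-! ### Meets, joins and implications in preorders -/

theorem IsHImp.congr_right {α : Type u} [Preorder α] {a b b' e : α} (h : IsHImp a b e)
    (hb : AntisymmRel (· ≤ ·) b b') : IsHImp a b' e := fun c m hm =>
  (h c m hm).trans ⟨fun h1 => h1.trans hb.1, fun h1 => h1.trans hb.2⟩

/-- Meets, joins and implications are unique up to isomorphism, and a monotone map respects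
isomorphism, so preservation need only be checked on one chosen instance of each. -/
theorem IsHeytingPrealgebraHom.of_exists {α β : Type u} [Preorder α] [Preorder β]
    (hα : IsHeytingPrealgebra α) {f : α → β} (hf : Monotone f)
    (htop : ∃ t, IsTop t ∧ IsTop (f t)) (hbot : ∃ t, IsBot t ∧ IsBot (f t))
    (hinf : ∀ a b, ∃ m, IsGLB {a, b} m ∧ IsGLB {f a, f b} (f m))
    (hsup : ∀ a b, ∃ m, IsLUB {a, b} m ∧ IsLUB {f a, f b} (f m))
    (himp : ∀ a b, ∃ e, IsHImp a b e ∧ IsHImp (f a) (f b) (f e)) :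
    IsHeytingPrealgebraHom f where
  monotone := hf
  map_top t ht x := by
    obtain ⟨s, -, hs⟩ := htop
    exact (hs x).trans (hf (ht s))
  map_bot t ht x := by
    obtain ⟨s, -, hs⟩ := hbot
    exact (hf (ht s)).trans (hs x)
  map_inf a b m hm := by
    obtain ⟨n, hn, hfn⟩ := hinf a b
    exact ArrowAlgebra.isGLB_congr hfn ((ArrowAlgebra.isGLB_antisymm hn hm).image hf)
  map_sup a b m hm := by
    obtain ⟨n, hn, hfn⟩ := hsup a b
    exact ArrowAlgebra.isLUB_congr hfn ((ArrowAlgebra.isLUB_antisymm hn hm).image hf)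
  map_himp a b e he := by
    obtain ⟨n, hn, hfn⟩ := himp a b
    exact ArrowAlgebra.isHImp_congr hfn ((ArrowAlgebra.isHImp_antisymm hα hn he).image hf)

theorem IsGLB.le_left {α : Type u} [Preorder α] {a b m : α} (h : IsGLB {a, b} m) : m ≤ a :=
  h.1 (Set.mem_insert _ _)

theorem IsGLB.le_right {α : Type u} [Preorder α] {a b m : α} (h : IsGLB {a, b} m) : m ≤ b :=
  h.1 (Set.mem_insert_of_mem _ rfl)

theorem IsGLB.le_of_le {α : Type u} [Preorder α] {a b m c : α} (h : IsGLB {a, b} m)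
    (ha : c ≤ a) (hb : c ≤ b) : c ≤ m :=
  h.2 (by rintro _ (rfl | rfl) <;> assumption)

theorem IsLUB.left_le {α : Type u} [Preorder α] {a b m : α} (h : IsLUB {a, b} m) : a ≤ m :=
  h.1 (Set.mem_insert _ _)

theorem IsLUB.right_le {α : Type u} [Preorder α] {a b m : α} (h : IsLUB {a, b} m) : b ≤ m :=
  h.1 (Set.mem_insert_of_mem _ rfl)

theorem IsLUB.le_of_le {α : Type u} [Preorder α] {a b m c : α} (h : IsLUB {a, b} m)
    (ha : a ≤ c) (hb : b ≤ c) : m ≤ c :=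
  h.2 (by rintro _ (rfl | rfl) <;> assumption)

theorem isGLB_pair_of_le {α : Type u} [Preorder α] {a b m : α} (ha : m ≤ a) (hb : m ≤ b)
    (h : ∀ c, c ≤ a → c ≤ b → c ≤ m) : IsGLB {a, b} m :=
  ⟨by rintro _ (rfl | rfl) <;> assumption,
    fun c hc => h c (hc (Set.mem_insert _ _)) (hc (Set.mem_insert_of_mem _ rfl))⟩

theorem isLUB_pair_of_le {α : Type u} [Preorder α] {a b m : α} (ha : a ≤ m) (hb : b ≤ m)
    (h : ∀ c, a ≤ c → b ≤ c → m ≤ c) : IsLUB {a, b} m :=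
  ⟨by rintro _ (rfl | rfl) <;> assumption,
    fun c hc => h c (hc (Set.mem_insert _ _)) (hc (Set.mem_insert_of_mem _ rfl))⟩

/-! ### Nuclei on a tripos and the subtriposes they induce -/

/-- Nuclei on a tripos: natural closure operators preserving binary meets. -/
structure TriposNucleus (P : Tripos.{u}) extends TriposTransformation P P where
  unit : ∀ X (φ : P.obj X), φ ≤ app X φ
  idem : ∀ X (φ : P.obj X), app X (app X φ) ≤ app X φ
  -- Meets exist only up to isomorphism, so `K a ∧ K b ≤ K (a ∧ b)` is expressed through an
  -- arbitrary lower bound `c` of `K a` and `K b`. The reverse inequality is monotonicity.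
  map_inf : ∀ X (a b m c : P.obj X), IsGLB {a, b} m → c ≤ app X a → c ≤ app X b → c ≤ app X m

namespace TriposNucleus

variable {P : Tripos.{u}} (K : TriposNucleus P)

/-- Predicates of `P` with the preorder `φ ≤ K ψ` induced by a nucleus `K`. -/
def Obj (_ : TriposNucleus P) (X : Type u) : Type u := P.obj X

instance (X : Type u) : Preorder (K.Obj X) where
  le φ ψ := LE.le (α := P.obj X) φ (K.app X ψ)
  le_refl φ := K.unit X φ
  le_trans _ _ ψ h h' := le_trans h ((K.monotone X h').trans (K.idem X ψ))

variable {K}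

theorem obj_le_iff {X : Type u} {φ ψ : K.Obj X} :
    φ ≤ ψ ↔ LE.le (α := P.obj X) φ (K.app X ψ) := Iff.rfl

theorem obj_le_of_le {X : Type u} {φ ψ : P.obj X} (h : φ ≤ ψ) : LE.le (α := K.Obj X) φ ψ :=
  le_trans (α := P.obj X) h (K.unit X ψ)

theorem obj_antisymmRel {X : Type u} {φ ψ : P.obj X} (h : AntisymmRel (· ≤ ·) φ ψ) :
    AntisymmRel (α := K.Obj X) (· ≤ ·) φ ψ := ⟨obj_le_of_le h.1, obj_le_of_le h.2⟩

theorem isTop_obj {X : Type u} {t : P.obj X} (h : IsTop t) : IsTop (α := K.Obj X) t :=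
  fun x => obj_le_of_le (h x)

theorem isBot_obj {X : Type u} {t : P.obj X} (h : IsBot t) : IsBot (α := K.Obj X) t :=
  fun x => obj_le_of_le (h x)

theorem isGLB_obj {X : Type u} {a b m : P.obj X} (h : IsGLB {a, b} m) :
    IsGLB (α := K.Obj X) {a, b} m :=
  isGLB_pair_of_le (obj_le_of_le h.le_left) (obj_le_of_le h.le_right)
    fun c hca hcb => K.map_inf X a b m c h hca hcb

theorem isLUB_obj {X : Type u} {a b m : P.obj X} (h : IsLUB {a, b} m) :
    IsLUB (α := K.Obj X) {a, b} m :=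
  isLUB_pair_of_le (obj_le_of_le h.left_le) (obj_le_of_le h.right_le)
    fun _ hac hbc => IsLUB.le_of_le (α := P.obj X) h hac hbc

/-- Implication in the new order is the old implication into the closure. If `c ≤ K e` with `e = (a
→ K b)`, then `c ∧ a ≤ K e ∧ K a ≤ K (e ∧ a) ≤ K (K b) ≤ K b`, which is where preservation of meets
enters. -/
theorem isHImp_obj {X : Type u} {a b e : P.obj X} (h : IsHImp a (K.app X b) e) :
    IsHImp (α := K.Obj X) a b e := by
  intro c m hm
  obtain ⟨n, hn⟩ := (P.heyting X).exists_inf c a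
  have hmn := ArrowAlgebra.isGLB_antisymm hm (isGLB_obj (K := K) hn)
  constructor
  · intro hce
    refine hmn.1.trans ?_
    obtain ⟨l, hl⟩ := (P.heyting X).exists_inf e a
    have hle : l ≤ K.app X b := (h e l hl).1 le_rfl
    have hnl : n ≤ K.app X l :=
      K.map_inf X e a l n hl (hn.le_left.trans hce) (hn.le_right.trans (K.unit X a))
    exact hnl.trans ((K.monotone X hle).trans (K.idem X b))
  · intro hmb
    exact obj_le_of_le ((h c n hn).2 (obj_le_iff.1 (hmn.2.trans hmb)))

variable (K)

theorem isHeytingPrealgebra_obj (X : Type u) : IsHeytingPrealgebra (K.Obj X) where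
  exists_top := (P.heyting X).exists_top.imp fun _ => isTop_obj
  exists_bot := (P.heyting X).exists_bot.imp fun _ => isBot_obj
  exists_inf a b := ((P.heyting X).exists_inf a b).imp fun _ => isGLB_obj
  exists_sup a b := ((P.heyting X).exists_sup a b).imp fun _ => isLUB_obj
  exists_himp a b := ((P.heyting X).exists_himp a (K.app X b)).imp fun _ => isHImp_obj

theorem map_monotone {X Y : Type u} (f : X → Y) :
    Monotone (α := K.Obj Y) (β := K.Obj X) (P.map f) := fun _ b h =>
  le_trans (α := P.obj X) ((P.map_hom f).monotone h) (K.natural f b).2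

theorem map_hom {X Y : Type u} (f : X → Y) :
    IsHeytingPrealgebraHom (α := K.Obj Y) (β := K.Obj X) (P.map f) := by
  refine .of_exists (K.isHeytingPrealgebra_obj Y) (K.map_monotone f) ?_ ?_ ?_ ?_ ?_
  · obtain ⟨t, ht⟩ := (P.heyting Y).exists_top
    exact ⟨t, isTop_obj ht, isTop_obj ((P.map_hom f).map_top t ht)⟩
  · obtain ⟨t, ht⟩ := (P.heyting Y).exists_bot
    exact ⟨t, isBot_obj ht, isBot_obj ((P.map_hom f).map_bot t ht)⟩
  · intro a b
    obtain ⟨m, hm⟩ := (P.heyting Y).exists_inf a b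
    exact ⟨m, isGLB_obj hm, isGLB_obj ((P.map_hom f).map_inf _ _ m hm)⟩
  · intro a b
    obtain ⟨m, hm⟩ := (P.heyting Y).exists_sup a b
    exact ⟨m, isLUB_obj hm, isLUB_obj ((P.map_hom f).map_sup _ _ m hm)⟩
  · intro a b
    obtain ⟨m, hm⟩ := (P.heyting Y).exists_himp a (K.app Y b)
    -- Reindexing carries `a → K b` to `f* a → f* (K b)`, and naturality of `K` replaces `f* (K b)`
    -- by `K (f* b)`.
    exact ⟨m, isHImp_obj hm,
      isHImp_obj (((P.map_hom f).map_himp _ _ m hm).congr_right (K.natural f b).symm)⟩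

/-- Universal quantification preserves closed predicates: by adjunction and naturality it suffices
that `K (f* ∀_f (K φ)) ≤ K φ`, which follows from the counit and idempotence. This makes `∀_f (K φ)`
a right adjoint for the new order. -/
theorem app_all_le {X Y : Type u} (f : X → Y) (φ : P.obj X) :
    K.app Y (P.all f (K.app X φ)) ≤ P.all f (K.app X φ) :=
  (P.all_adj f _ _).1 ((K.natural f _).2.trans
    ((K.monotone X ((P.all_adj f).l_u_le _)).trans (K.idem X φ)))

theorem all_monotone (P : Tripos.{u}) {X Y : Type u} (f : X → Y) : Monotone (P.all f) :=
  (P.all_adj f).monotone_u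

/-- The tripos of predicates with the preorder induced by a nucleus. -/
def tripos : Tripos.{u} where
  obj X := K.Obj X
  heyting := K.isHeytingPrealgebra_obj
  map f φ := P.map f φ
  map_hom f := K.map_hom f
  map_id φ := obj_antisymmRel (P.map_id φ)
  map_comp f g φ := obj_antisymmRel (P.map_comp f g φ)
  -- The left adjoint survives unchanged, since `∃_f φ ≤ K ψ` iff `φ ≤ f* (K ψ) ≃ K (f* ψ)`. The
  -- right adjoint is applied to the closure, as the order sees a predicate on its right only
  -- through `K`.
  ex f φ := P.ex f φ
  all f φ := P.all f (K.app _ φ)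
  ex_adj f φ ψ := (P.ex_adj f φ (K.app _ ψ)).trans
    ⟨fun h => le_trans (α := P.obj _) h (K.natural f ψ).2,
      fun h => le_trans (α := P.obj _) h (K.natural f ψ).1⟩
  all_adj f φ ψ := (P.all_adj f φ (K.app _ ψ)).trans
    ⟨fun h => le_trans (α := P.obj _) h (K.unit _ _),
      fun h => le_trans (α := P.obj _) h (K.app_all_le f ψ)⟩
  beckChevalley f g h k hc hp φ := obj_antisymmRel <|
    (P.beckChevalley f g h k hc hp (K.app _ φ)).trans
      ((K.natural f φ).symm.image (all_monotone P g))
  exists_generic := by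
    obtain ⟨S, σ, h⟩ := P.exists_generic
    exact ⟨S, σ, fun X φ => (h X φ).imp fun _ hc => obj_antisymmRel hc⟩

/-- The subtripos induced by a nucleus. -/
def subtripos : Subtripos P where
  tripos := K.tripos
  incl :=
    { inverse := ⟨fun _ φ => φ, fun _ _ _ h => obj_le_of_le h, fun _ _ => AntisymmRel.refl _ _⟩
      direct := ⟨K.app, fun X _ ψ h => (K.monotone X h).trans (K.idem X ψ), K.natural⟩
      cartesian := ⟨fun _ _ h => isTop_obj h, fun _ _ _ _ h => isGLB_obj h⟩
      adj := fun _ _ _ => Iff.rfl }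
  isInclusion X φ _ h := (K.unit X φ).trans h

end TriposNucleus

/-! ### The order on subtriposes in terms of nuclei -/

namespace Subtripos

variable {P : Tripos.{u}}

/-- The nucleus `Φ₊ Φ⁺` of a subtripos. -/
def nucleus (Φ : Subtripos P) : TriposNucleus P where
  app X φ := Φ.incl.direct.app X (Φ.incl.inverse.app X φ)
  monotone X := (Φ.incl.direct.monotone X).comp (Φ.incl.inverse.monotone X)
  natural f φ := ((Φ.incl.inverse.natural f φ).image (Φ.incl.direct.monotone _)).trans
    (Φ.incl.direct.natural f _)
  unit X φ := (Φ.incl.adj X).le_u_l φ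
  idem X _ := Φ.incl.direct.monotone X ((Φ.incl.adj X).l_u_le _)
  map_inf X a b m _ hm ha hb := (Φ.incl.adj X _ _).1 <|
    (Φ.incl.cartesian.map_inf X a b m hm).le_of_le ((Φ.incl.adj X _ _).2 ha)
      ((Φ.incl.adj X _ _).2 hb)

/-- By the counit, predicates in the image of the direct image are closed. -/
theorem nucleus_direct_le (Φ : Subtripos P) (X : Type u) (φ : Φ.tripos.obj X) :
    Φ.nucleus.app X (Φ.incl.direct.app X φ) ≤ Φ.incl.direct.app X φ :=
  Φ.incl.direct.monotone X ((Φ.incl.adj X).l_u_le φ)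

/-- The factorization of `Φ` through `Ψ` when the nucleus of `Ψ` is below that of `Φ`. -/
def factor {Φ Ψ : Subtripos P} (h : ∀ X φ, Ψ.nucleus.app X φ ≤ Φ.nucleus.app X φ) :
    GeometricMorphism Φ.tripos Ψ.tripos where
  inverse := ⟨fun X ψ => Φ.incl.inverse.app X (Ψ.incl.direct.app X ψ),
    fun X => (Φ.incl.inverse.monotone X).comp (Ψ.incl.direct.monotone X),
    fun f ψ => ((Ψ.incl.direct.natural f ψ).image (Φ.incl.inverse.monotone _)).trans
      (Φ.incl.inverse.natural f _)⟩
  direct := ⟨fun X φ => Ψ.incl.inverse.app X (Φ.incl.direct.app X φ),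
    fun X => (Ψ.incl.inverse.monotone X).comp (Φ.incl.direct.monotone X),
    fun f φ => ((Φ.incl.direct.natural f φ).image (Ψ.incl.inverse.monotone _)).trans
      (Ψ.incl.inverse.natural f _)⟩
  cartesian :=
    -- `Ψ₊` preserves finite meets as a right adjoint, and `Φ⁺` does so because it is cartesian.
    { map_top := fun X t ht => Φ.incl.cartesian.map_top X _ (Ψ.direct_isTop X t ht)
      map_inf := fun X _ _ _ hm => Φ.incl.cartesian.map_inf X _ _ _ <|
        isGLB_pair_of_le (Ψ.incl.direct.monotone X hm.le_left)
          (Ψ.incl.direct.monotone X hm.le_right)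
          fun _ ha hb => (Ψ.incl.adj X _ _).1
            (hm.le_of_le ((Ψ.incl.adj X _ _).2 ha) ((Ψ.incl.adj X _ _).2 hb)) }
  -- Both sides amount to `Ψ₊ ψ ≤ Φ₊ φ`: the nucleus inequality makes `Φ₊ φ` closed for `Ψ`, so `Ψ₊
  -- Ψ⁺ Φ₊ φ ≃ Φ₊ φ`, and `Ψ₊` reflects the order.
  adj X _ φ := (Φ.incl.adj X _ _).trans
    ⟨fun h1 => Ψ.isInclusion X _ _ (h1.trans (Ψ.nucleus.unit X _)),
      fun h1 => (Ψ.incl.direct.monotone X h1).trans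
        ((h X _).trans (Φ.nucleus_direct_le X φ))⟩

/-- If `Φ` factors through `Ψ`, then `Φ₊ Φ⁺ φ` is isomorphic to a predicate in the image of `Ψ₊`, so
it is a `Ψ`-closed predicate above `φ` and dominates the `Ψ`-closure of `φ`. Conversely, `factor`
has direct image `Ψ⁺ Φ₊`, and `Ψ₊ Ψ⁺ Φ₊ ≃ Φ₊` under the inequality. -/
theorem le_iff_nucleus_le {Φ Ψ : Subtripos P} :
    Φ ≤ Ψ ↔ ∀ X φ, Ψ.nucleus.app X φ ≤ Φ.nucleus.app X φ := by
  constructor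
  · rintro ⟨Θ, hΘ⟩ X φ
    have h := hΘ X (Φ.incl.inverse.app X φ)
    have h1 : φ ≤ Ψ.incl.direct.app X (Θ.direct.app X (Φ.incl.inverse.app X φ)) :=
      (Φ.nucleus.unit X φ).trans h.1
    exact ((Ψ.nucleus.monotone X h1).trans (Ψ.nucleus_direct_le X _)).trans h.2
  · intro h
    exact ⟨factor h, fun X φ =>
      ⟨Ψ.nucleus.unit X _, (h X _).trans (Φ.nucleus_direct_le X φ)⟩⟩

/-! ### Open and closed subtriposes and their complements -/

/-- Open subtriposes with the same witness are equivalent. -/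
theorem IsOpenWith.toClass_eq {Φ Ψ : Subtripos P} {α : P.obj PUnit.{u + 1}}
    (hΦ : Φ.IsOpenWith α) (hΨ : Ψ.IsOpenWith α) : Φ.toClass = Ψ.toClass := by
  have h X φ := ArrowAlgebra.isHImp_antisymm (P.heyting X) (hΦ X φ) (hΨ X φ)
  exact le_antisymm (le_iff_nucleus_le.2 fun X φ => (h X φ).2)
    (le_iff_nucleus_le.2 fun X φ => (h X φ).1)

/-- The nucleus `Φ₊ Φ⁺ Ψ₊ Ψ⁺` for an open subtripos `Φ`. -/
def IsOpenWith.infNucleus {Φ : Subtripos P} {α : P.obj PUnit.{u + 1}} (hΦ : Φ.IsOpenWith α)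
    (Ψ : Subtripos P) : TriposNucleus P where
  app X φ := Φ.nucleus.app X (Ψ.nucleus.app X φ)
  monotone X := (Φ.nucleus.monotone X).comp (Ψ.nucleus.monotone X)
  natural f φ := ((Ψ.nucleus.natural f φ).image (Φ.nucleus.monotone _)).trans
    (Φ.nucleus.natural f _)
  unit X φ := (Ψ.nucleus.unit X φ).trans (Φ.nucleus.unit X _)
  idem X φ := by
    set a := P.map (fun _ : X => PUnit.unit) α
    set e := Φ.nucleus.app X (Ψ.nucleus.app X φ)
    -- Composites of nuclei need not be idempotent. Here `e = (α → Ψ φ)` is closed for `Ψ`, because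
    -- `Ψ e ∧ α ≤ Ψ (e ∧ α) ≤ Ψ (Ψ φ) ≤ Ψ φ`.
    suffices h : Ψ.nucleus.app X e ≤ e from
      (Φ.nucleus.monotone X h).trans (Φ.nucleus.idem X _)
    obtain ⟨m, hm⟩ := (P.heyting X).exists_inf (Ψ.nucleus.app X e) a
    obtain ⟨n, hn⟩ := (P.heyting X).exists_inf e a
    have hn' : n ≤ Ψ.nucleus.app X φ := (hΦ X (Ψ.nucleus.app X φ) e n hn).1 le_rfl
    refine (hΦ X (Ψ.nucleus.app X φ) _ m hm).2 ?_
    have hmn : m ≤ Ψ.nucleus.app X n :=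
      Ψ.nucleus.map_inf X e a n m hn hm.le_left (hm.le_right.trans (Ψ.nucleus.unit X a))
    exact hmn.trans ((Ψ.nucleus.monotone X hn').trans (Ψ.nucleus.idem X φ))
  map_inf X a b m c hm ha hb := by
    obtain ⟨n, hn⟩ := (P.heyting X).exists_inf (Ψ.nucleus.app X a) (Ψ.nucleus.app X b)
    exact (Φ.nucleus.map_inf X _ _ n c hn ha hb).trans (Φ.nucleus.monotone X
      (Ψ.nucleus.map_inf X a b m n hm hn.le_left hn.le_right))

/-- The pointwise meet of the nuclei of two subtriposes. -/
noncomputable def supNucleus (Φ Ψ : Subtripos P) : TriposNucleus P where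
  app X φ := ((P.heyting X).exists_inf (Φ.nucleus.app X φ) (Ψ.nucleus.app X φ)).choose
  monotone X φ ψ h := by
    have h1 := ((P.heyting X).exists_inf (Φ.nucleus.app X φ) (Ψ.nucleus.app X φ)).choose_spec
    exact ((P.heyting X).exists_inf (Φ.nucleus.app X ψ) (Ψ.nucleus.app X ψ)).choose_spec.le_of_le
      (h1.le_left.trans (Φ.nucleus.monotone X h)) (h1.le_right.trans (Ψ.nucleus.monotone X h))
  natural {X Y} f φ := by
    have h1 := ((P.heyting X).exists_inf (Φ.nucleus.app X (P.map f φ))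
      (Ψ.nucleus.app X (P.map f φ))).choose_spec
    have h2 := (P.map_hom f).map_inf _ _ _
      ((P.heyting Y).exists_inf (Φ.nucleus.app Y φ) (Ψ.nucleus.app Y φ)).choose_spec
    exact ⟨h2.le_of_le (h1.le_left.trans (Φ.nucleus.natural f φ).1)
        (h1.le_right.trans (Ψ.nucleus.natural f φ).1),
      h1.le_of_le (h2.le_left.trans (Φ.nucleus.natural f φ).2)
        (h2.le_right.trans (Ψ.nucleus.natural f φ).2)⟩
  unit X φ := ((P.heyting X).exists_inf _ _).choose_spec.le_of_le (Φ.nucleus.unit X φ)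
    (Ψ.nucleus.unit X φ)
  idem X φ := by
    set e := ((P.heyting X).exists_inf (Φ.nucleus.app X φ) (Ψ.nucleus.app X φ)).choose
    have h1 : IsGLB _ e :=
      ((P.heyting X).exists_inf (Φ.nucleus.app X φ) (Ψ.nucleus.app X φ)).choose_spec
    have h2 := ((P.heyting X).exists_inf (Φ.nucleus.app X e) (Ψ.nucleus.app X e)).choose_spec
    exact h1.le_of_le
      (h2.le_left.trans ((Φ.nucleus.monotone X h1.le_left).trans (Φ.nucleus.idem X φ)))
      (h2.le_right.trans ((Ψ.nucleus.monotone X h1.le_right).trans (Ψ.nucleus.idem X φ)))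
  map_inf X a b m c hm ha hb := by
    have h1 := ((P.heyting X).exists_inf (Φ.nucleus.app X a) (Ψ.nucleus.app X a)).choose_spec
    have h2 := ((P.heyting X).exists_inf (Φ.nucleus.app X b) (Ψ.nucleus.app X b)).choose_spec
    exact ((P.heyting X).exists_inf (Φ.nucleus.app X m) (Ψ.nucleus.app X m)).choose_spec.le_of_le
      (Φ.nucleus.map_inf X a b m c hm (ha.trans h1.le_left) (hb.trans h2.le_left))
      (Ψ.nucleus.map_inf X a b m c hm (ha.trans h1.le_right) (hb.trans h2.le_right))

theorem isGLB_supNucleus (Φ Ψ : Subtripos P) (X : Type u) (φ : P.obj X) :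
    IsGLB {Φ.nucleus.app X φ, Ψ.nucleus.app X φ} ((supNucleus Φ Ψ).app X φ) :=
  ((P.heyting X).exists_inf _ _).choose_spec

theorem isTop_nucleus_bot (X : Type u) (φ : P.obj X) :
    IsTop ((⊥ : Subtripos P).nucleus.app X φ) :=
  (P.heyting X).exists_top.choose_spec

variable {Φ Ψ : Subtripos P} {α : P.obj PUnit.{u + 1}}

/-- If `α ≤ Ψ₊ Ψ⁺ φ` and `Ψ` is contained in the open subtripos with witness `α`, then `Ψ₊ Ψ⁺ φ`
is a top predicate. -/
theorem IsOpenWith.isTop_nucleus (hΦ : Φ.IsOpenWith α) (h : Ψ ≤ Φ) {X : Type u} {φ : P.obj X}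
    (hα : P.map (fun _ => PUnit.unit) α ≤ Ψ.nucleus.app X φ) : IsTop (Ψ.nucleus.app X φ) := by
  intro ψ
  obtain ⟨m, hm⟩ := (P.heyting X).exists_inf ψ (P.map (fun _ => PUnit.unit) α)
  have h1 : ψ ≤ Φ.nucleus.app X (Ψ.nucleus.app X φ) :=
    (hΦ X (Ψ.nucleus.app X φ) ψ m hm).2 (hm.le_right.trans hα)
  exact h1.trans ((le_iff_nucleus_le.1 h X _).trans (Ψ.nucleus.idem X φ))

/-- Open and closed subtriposes with the same witness are complementary. -/
theorem IsOpenWith.isCompl (hΦ : Φ.IsOpenWith α) (hΨ : Ψ.IsClosedWith α) :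
    IsCompl Φ.toClass Ψ.toClass := by
  constructor
  · intro x
    induction x using Quotient.inductionOn with | _ Ξ
    intro h1 h2
    replace h1 : Ξ ≤ Φ := h1
    replace h2 : Ξ ≤ Ψ := h2
    change Ξ ≤ ⊥
    -- Containment in the closed subtripos gives `α ≤ φ ∨ α ≤ Ξ φ`; containment in the open one then
    -- forces `Ξ φ` to be top.
    exact le_iff_nucleus_le.2 fun X φ => hΦ.isTop_nucleus h1
      ((hΨ X φ).right_le.trans (le_iff_nucleus_le.1 h2 X φ)) _
  · intro x
    induction x using Quotient.inductionOn with | _ Ξ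
    intro h1 h2
    replace h1 : Φ ≤ Ξ := h1
    replace h2 : Ψ ≤ Ξ := h2
    change ⊤ ≤ Ξ
    refine le_iff_nucleus_le.2 fun X φ => ?_
    change Ξ.nucleus.app X φ ≤ φ
    set a := P.map (fun _ : X => PUnit.unit) α
    -- The claim follows from `Ξ φ ≤ φ ∨ α` and `Ξ φ ∧ α ≤ φ` by distributivity. The implication `e
    -- = (Ξ φ → φ)` supplies it: both `φ` and `α` lie below `e`, so `Ξ φ ≤ e`, and therefore `Ξ φ ≤
    -- φ`.
    obtain ⟨e, he⟩ := (P.heyting X).exists_himp (Ξ.nucleus.app X φ) φ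
    obtain ⟨m, hm⟩ := (P.heyting X).exists_inf (Ξ.nucleus.app X φ) a
    obtain ⟨n, hn⟩ := (P.heyting X).exists_inf φ (Ξ.nucleus.app X φ)
    have hmφ : m ≤ φ := (hΦ X φ _ m hm).1 (le_iff_nucleus_le.1 h1 X φ)
    have hφe : φ ≤ e := (he φ n hn).2 hn.le_left
    have hae : a ≤ e := (he a m (Set.pair_comm _ _ ▸ hm)).2 hmφ
    have h3 : Ξ.nucleus.app X φ ≤ e :=
      (le_iff_nucleus_le.1 h2 X φ).trans ((hΨ X φ).le_of_le hφe hae)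
    exact (he _ (Ξ.nucleus.app X φ) (isGLB_pair_of_le le_rfl le_rfl fun _ h _ => h)).1 h3

/-- Any complement of an open subtripos is equivalent to the closed subtripos with the same
witness. -/
theorem IsOpenWith.eq_of_isCompl (hΦ : Φ.IsOpenWith α) (hΨ : Ψ.IsClosedWith α)
    {x : SubtriposClass P} (hx : IsCompl Φ.toClass x) : x = Ψ.toClass := by
  induction x using Quotient.inductionOn with | _ Ξ
  have hd : ∀ Υ : Subtripos P, Υ ≤ Φ → Υ ≤ Ξ → Υ ≤ ⊥ := fun Υ h1 h2 =>
    hx.disjoint (show Υ.toClass ≤ Φ.toClass from h1) h2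
  have hc : ∀ Υ : Subtripos P, Φ ≤ Υ → Ξ ≤ Υ → ⊤ ≤ Υ := fun Υ h1 h2 =>
    hx.codisjoint (show Φ.toClass ≤ Υ.toClass from h1) h2
  -- The test object for disjointness, a common lower bound of `Φ` and `Ξ`: it shows that `α → Ξ φ`
  -- is top for every `φ`.
  have h1 := le_iff_nucleus_le.1 <| hd (hΦ.infNucleus Ξ).subtripos
    (le_iff_nucleus_le.2 fun X φ => Φ.nucleus.monotone X (Ξ.nucleus.unit X φ))
    (le_iff_nucleus_le.2 fun X φ => Φ.nucleus.unit X _)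
  -- The test object for codisjointness, a common upper bound: it shows that `(α → χ) ∧ Ξ χ ≤ χ` for
  -- every `χ`.
  have h2 := le_iff_nucleus_le.1 <| hc (supNucleus Φ Ξ).subtripos
    (le_iff_nucleus_le.2 fun X φ => (isGLB_supNucleus Φ Ξ X φ).le_left)
    (le_iff_nucleus_le.2 fun X φ => (isGLB_supNucleus Φ Ξ X φ).le_right)
  change Ξ.toClass = Ψ.toClass
  refine le_antisymm (le_iff_nucleus_le.2 fun X φ => ?_) (le_iff_nucleus_le.2 fun X φ => ?_)
  · refine (hΨ X φ).le_of_le (Ξ.nucleus.unit X φ) ?_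
    set a := P.map (fun _ : X => PUnit.unit) α
    have h3 : a ≤ Φ.nucleus.app X (Ξ.nucleus.app X φ) :=
      (isTop_nucleus_bot X φ a).trans (h1 X φ)
    exact (hΦ X (Ξ.nucleus.app X φ) a a (isGLB_pair_of_le le_rfl le_rfl fun _ h _ => h)).1 h3
  · have h3 := hΨ X φ
    change IsLUB _ (Ψ.nucleus.app X φ) at h3
    set a := P.map (fun _ : X => PUnit.unit) α
    obtain ⟨m, hm⟩ := (P.heyting X).exists_inf (Ξ.nucleus.app X φ) a
    -- Take `χ = φ ∨ α`: then `α → χ` is top because `α ≤ χ`, and `Ξ φ ≤ Ξ χ` by monotonicity.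
    refine (isGLB_supNucleus Φ Ξ X _).le_of_le ?_ (Ξ.nucleus.monotone X h3.left_le) |>.trans
      (h2 X (Ψ.nucleus.app X φ))
    exact (hΦ X (Ψ.nucleus.app X φ) _ m hm).2 (hm.le_right.trans h3.right_le)

end Subtripos

/-! ### Open and closed nuclei on arrow algebras; the witness `(⊥, ⊤)` -/

namespace ArrowAlgebra

theorem openNucleus_isOpenWith (A : ArrowAlgebra.{u}) (a : A.carrier) :
    (A.openNucleus a).subtripos.IsOpenWith fun _ => a := fun X φ =>
  isHImp_imp (A := A) (fun _ : X => a) φ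

theorem closedNucleus_isClosedWith (A : ArrowAlgebra.{u}) (a : A.carrier) :
    (A.closedNucleus a).subtripos.IsClosedWith fun _ => a := fun X φ =>
  isLUB_plus (A := A) φ fun _ : X => a

/-- The first component is `(⊥ → x₀) ∧ (⊤ → x₁)`, whose first factor is `⊤` by modifiability, so
both components are `∂ x₁`. -/
theorem Modifiable.botTop_imp {A : ArrowAlgebra.{u}} (hA : A.Modifiable)
    (x : (A.sierpinski hA.binaryImplicative).carrier) :
    (A.sierpinski hA.binaryImplicative).imp (A.botTop hA.binaryImplicative) x =
      (A.diag hA.binaryImplicative).toFun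
        (A.del ((A.sndProj hA.binaryImplicative).toFun x)) := by
  refine Subtype.ext (Prod.ext ?_ rfl)
  change A.imp ⊥ x.1.1 ⊓ A.imp ⊤ x.1.2 = A.imp ⊤ x.1.2
  rw [hA.bot_imp, top_inf_eq]

/-- The Heyting implication from `(⊥, ⊤)` is `δ ∂ π₁`, while the closure of the inclusion is `δ π₁`.
They agree up to isomorphism because `∂` is logically the identity and `δ` preserves entailment. -/
theorem Modifiable.sndInclusion_isOpenWith {A : ArrowAlgebra.{u}} (hA : A.Modifiable) :
    (A.sndInclusion hA.binaryImplicative).IsOpenWith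
      (fun _ => A.botTop hA.binaryImplicative) := by
  intro X φ
  have h := isHImp_imp (A := A.sierpinski hA.binaryImplicative)
    (fun _ : X => A.botTop hA.binaryImplicative) φ
  simp only [hA.botTop_imp] at h
  exact isHImp_congr h ⟨(A.diag hA.binaryImplicative).entails (del_entails _),
    (A.diag hA.binaryImplicative).entails (entails_del _)⟩

end ArrowAlgebra

theorem proposition9p11 (A : ArrowAlgebra.{u}) (hA : A.Modifiable) :
    -- the inclusion of `P_A` induced by the second projection is open, witnessed by `(⊥, ⊤)`
    (A.sndInclusion hA.binaryImplicative).IsOpenWith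
      (fun _ => A.botTop hA.binaryImplicative) ∧
    -- it is equivalent to the subtripos induced by the nucleus `o(x) = (⊥, ⊤) → x`
    (A.sndInclusion hA.binaryImplicative).toClass =
      ((A.sierpinski hA.binaryImplicative).openNucleus
        (A.botTop hA.binaryImplicative)).subtripos.toClass ∧
    -- the modified tripos `M_A` is closed, witnessed by the same element
    hA.modifiedTripos.IsClosedWith (fun _ => A.botTop hA.binaryImplicative) ∧
    -- and it is the complement of `P_A` among the subtriposes of `P_{A^→}` up to equivalence
    IsCompl (A.sndInclusion hA.binaryImplicative).toClass hA.modifiedTripos.toClass ∧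
    ∀ x : SubtriposClass (A.sierpinski hA.binaryImplicative).tripos,
      IsCompl (A.sndInclusion hA.binaryImplicative).toClass x → x = hA.modifiedTripos.toClass := by
  have ho := hA.sndInclusion_isOpenWith
  have hc : hA.modifiedTripos.IsClosedWith _ := ArrowAlgebra.closedNucleus_isClosedWith _ _
  exact ⟨ho, ho.toClass_eq (ArrowAlgebra.openNucleus_isOpenWith _ _), hc, ho.isCompl hc,
    fun _ hx => ho.eq_of_isCompl hc hx⟩
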